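/- Setting. Let $\mathcal X=\{1,\dots,n\}$, let $Q$ be a $Q$-matrix on $\mathcal X$ ($Q_{ij}\ge 0$ for $i\ne j$, zero row sums), let $\pi_i>0$ satisfy detailed balance $Q_{ij}\pi_i=Q_{ji}\pi_j$, and put $\omega_{ij}=Q_{ij}\pi_i$, $E=\{(i,j): i\neq j,\ \omega_{ij}>0\}$, $(\operatorname{div}_\omega m)_i=\sum_{j:(i,j)\in E}\sqrt{\omega_{ij}}\,m_{ij}$. Let $\mathcal P(\mathcal X)$ be the probability simplex. Let $\theta:[0,\infty)^2\to[0,\infty)$ be symmetric, continuous, $C^1$ on $(0,\infty)^2$, with $\theta(x,y)>0$ if $xy\ne0$ and $\theta(x,y)=0$ if $xy=0$, and jointly concave; write $\theta_{ij}(p)=\theta(p_i/\pi_i,p_j/\pi_j)$. For $(i,j)\in E$ let $L_{ij}=L_{ji}:\mathbb R\to\mathbb R$ be even, strictly convex and superlinear ($L_{ij}(a)/|a|\to\infty$ as $|a|\to\infty$) with $L_{ij}(0)=0$. Let $\mathcal F,\mathcal G\in C^1(\mathcal P(\mathcal X))$ be concave, $t\le T$, and $p^0\in\mathcal P(\mathcal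 X)$. Control problem: maximize $$\mathcal G(p_T)-\int_t^T\Big(\tfrac12\sum_{(i,j)\in E}\theta_{ij}(p_s)L_{ij}(v_s(ij))-\mathcal F(p_s)\Big)ds$$ over curves $p:[t,T]\to\mathcal P(\mathcal X)$ and fields $v$ with $v_s(ij)=-v_s(ji)$ on $E$, subject to $\frac{d}{ds}p_s+\operatorname{div}_\omega(\theta(p_s)v_s)=0$, $p_t=p^0$. Here the flux $\theta(p)v$ is integrable, $p$ is absolutely continuous, the equation holds for a.e. $s$, and the running cost is integrable. Let $\mathcal U(p^0,t)$ be the supremum. Density-flux problem: maximize $$\mathcal G(p_T)-\int_t^T\Big(\tfrac12\sum_{(i,j)\in E}\theta_{ij}(p_s)L_{ij}\Big(\frac{m_s(ij)}{\theta_{ij}(p_s)}\Big)-\mathcal F(p_s)\Big)ds$$ over curves $p:[t,T]\to\mathcal P(\mathcal X)$ and integrable fluxes $m$ with $m_s(ij)=-m_s(ji)$ on $E$, subject to the linear constraint $\frac{d}{ds}p_s+\operatorname{div}_\omega m_s=0$ (a.e.; $p$ absolutely continuous), $p_t=p^0$, and of finite running cost, where $\theta_{ij}(p)L_{ij}(m_{ij}/\theta_{ij}(p))$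 is read as $0$ if $m_{ij}=\theta_{ij}(p)=0$ and as $+\infty$ if $m_{ij}\neq0=\theta_{ij}(p)$. Claim. 1. If $(p,v)$ is feasible for the control problem, then $(p,m)$ with $m_{ij}=\theta_{ij}(p)v_{ij}$ is feasible for the density-flux problem, with the same payoff; and every feasible $(p,m)$ arises in this way. 2. The density-flux problem is a convex optimization problem: its feasible set is convex and its payoff is concave on it. 3. $\mathcal U(p^0,t)$ is finite and the density-flux problem has a solution: its maximum is attained and equals $\mathcal U(p^0,t)$. The supremum of the density-flux payoff over feasible pairs $(p,m)$ that are $C^1$ on $[t,T]$ is also $\mathcal U(p^0,t)$; if $p^0_i>0$ for all $i$, so is the supremum of the control payoff over feasible pairs $(p,v)$ that are $C^1$ on $[t,T]$. 4. The solution is unique as long as the density is positive: if $(p,m)$ and $(\bar p,\bar m)$ are solutions of the density-flux problem, $\tau\in[t,T]$, and $p_s(i)>0$ for all $i$ and all $s\in[t,\tau)$, then $p_s=\bar p_s$ for all $s\in[t,\tau]$ and $m_s=\bar m_s$ on $E$ for a.e. $s\in[t,\tau]$. In particular (take $\tau=T$), a solution with $p_s>0$ on $[t,T)$ is the only solution.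 -/

import Mathlib

open Set MeasureTheory Filter

noncomputable section

/-- A reversible continuous-time Markov chain on the finite state space `Fin n`: a `Q`-matrix
together with a positive invariant measure `stat` in detailed balance with it. -/
structure ReversibleChain (n : ℕ) where
  Q : Matrix (Fin n) (Fin n) ℝ
  stat : Fin n → ℝ
  nonneg : ∀ i j, i ≠ j → 0 ≤ Q i j
  row_sum : ∀ i, ∑ j, Q i j = 0
  stat_pos : ∀ i, 0 < stat i
  detailed_balance : ∀ i j, Q i j * stat i = Q j i * stat j

namespace ReversibleChain

variable {n : ℕ} (C : ReversibleChain n)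

/-- The edge weight `ω i j = Q i j * π i`. -/
def weight (i j : Fin n) : ℝ := C.Q i j * C.stat i

/-- The (directed) edges: `(i, j)` with `i ≠ j` and positive weight. -/
def edges : Finset (Fin n × Fin n) :=
  Finset.univ.filter (fun e => e.1 ≠ e.2 ∧ 0 < C.weight e.1 e.2)

/-- The neighbours of `i`. -/
def nbhd (i : Fin n) : Finset (Fin n) :=
  Finset.univ.filter (fun j => (i, j) ∈ C.edges)

/-- The weighted graph divergence of a vector field. Only its values on edges matter. -/
def divergence (m : Fin n → Fin n → ℝ) (i : Fin n) : ℝ :=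
  ∑ j ∈ C.nbhd i, Real.sqrt (C.weight i j) * m i j

/-- `θ_ij(p) = θ (p_i / π_i, p_j / π_j)`. -/
def act (θ : ℝ → ℝ → ℝ) (p : Fin n → ℝ) (i j : Fin n) : ℝ :=
  θ (p i / C.stat i) (p j / C.stat j)

end ReversibleChain

/-- The conditions on an activation function on `[0, ∞) × [0, ∞)`: symmetric, positive off the axes,
continuous and of class `C¹` off the axes, zero on the axes. -/
structure IsActivation (θ : ℝ → ℝ → ℝ) : Prop where
  symm : ∀ x y, 0 ≤ x → 0 ≤ y → θ x y = θ y x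
  pos : ∀ x y, 0 ≤ x → 0 ≤ y → x * y ≠ 0 → 0 < θ x y
  continuousOn : ContinuousOn (fun z : ℝ × ℝ => θ z.1 z.2) (Ici 0 ×ˢ Ici 0)
  contDiffOn : ContDiffOn ℝ 1 (fun z : ℝ × ℝ => θ z.1 z.2) (Ioi 0 ×ˢ Ioi 0)
  zero : ∀ x y, 0 ≤ x → 0 ≤ y → x * y = 0 → θ x y = 0

/-- The conditions on the family of Lagrangians: symmetric in the edge, even, zero at zero,
strictly convex, superlinear. -/
structure IsLagrangian {n : ℕ} (C : ReversibleChain n) (L : Fin n → Fin n → ℝ → ℝ) : Prop where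
  symm : ∀ i j, (i, j) ∈ C.edges → ∀ a, L i j a = L j i a
  even : ∀ i j, (i, j) ∈ C.edges → ∀ a, L i j (-a) = L i j a
  zero : ∀ i j, (i, j) ∈ C.edges → L i j 0 = 0
  strictConvex : ∀ i j, (i, j) ∈ C.edges → StrictConvexOn ℝ univ (L i j)
  superlinear : ∀ i j, (i, j) ∈ C.edges →
    Tendsto (fun a => L i j a / |a|) (cocompact ℝ) atTop

/-- A curve of densities paired with a time-dependent field (a velocity or a flux). -/
abbrev PathPair (n : ℕ) : Type := (ℝ → Fin n → ℝ) × (ℝ → Fin n → Fin n → ℝ)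

namespace ReversibleChain

variable {n : ℕ} (C : ReversibleChain n) (θ : ℝ → ℝ → ℝ) (L : Fin n → Fin n → ℝ → ℝ)
  (F G : (Fin n → ℝ) → ℝ) (t T : ℝ) (p₀ : Fin n → ℝ)

/-- The flux `m_ij = θ_ij(p) v_ij` of a velocity field `v`. -/
def flux (p : ℝ → Fin n → ℝ) (v : ℝ → Fin n → Fin n → ℝ) : ℝ → Fin n → Fin n → ℝ :=
  fun s i j => C.act θ (p s) i j * v s i j

/-- `p` is a curve in the probability simplex which on `[t, T]` solves `p' + div m = 0`,
`p t = p₀`. The equation is written in integrated form with an integrable flux, that is, `p` is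
absolutely continuous and the equation holds almost everywhere. (For a continuous flux this is the
same as `p` being `C¹` with the equation at every time.) -/
structure SolvesContinuity (p : ℝ → Fin n → ℝ) (m : ℝ → Fin n → Fin n → ℝ) : Prop where
  mem_simplex : ∀ s ∈ Icc t T, p s ∈ stdSimplex ℝ (Fin n)
  integrable : ∀ i j, (i, j) ∈ C.edges → IntegrableOn (fun s => m s i j) (Icc t T)
  eqn : ∀ s ∈ Icc t T, ∀ i, p s i = p₀ i - ∫ r in t..s, C.divergence (m r) i

/-- Antisymmetry of a time-dependent field on the edges. -/
def IsAntisymm (u : ℝ → Fin n → Fin n → ℝ) : Prop :=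
  ∀ s ∈ Icc t T, ∀ i j, (i, j) ∈ C.edges → u s i j = -u s j i

/-- The feasible density-velocity pairs of the control problem, of finite running cost. -/
def controls : Set (PathPair n) :=
  {z | C.IsAntisymm t T z.2 ∧ C.SolvesContinuity t T p₀ z.1 (C.flux θ z.1 z.2) ∧
    ∀ i j, (i, j) ∈ C.edges →
      IntegrableOn (fun s => C.act θ (z.1 s) i j * L i j (z.2 s i j)) (Icc t T)}

/-- The payoff of the control problem. -/
def controlPayoff (z : PathPair n) : ℝ :=
  G (z.1 T) - ∫ s in t..T,
    ((1 / 2) * ∑ e ∈ C.edges, C.act θ (z.1 s) e.1 e.2 * L e.1 e.2 (z.2 s e.1 e.2) - F (z.1 s))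

/-- The value function of the control problem. -/
def value : ℝ := sSup (C.controlPayoff θ L F G t T '' C.controls θ L t T p₀)

/-- The feasible density-flux pairs of finite running cost. The running cost
`θ_ij(p) L_ij(m_ij / θ_ij(p))` is understood as `0` if `m_ij = θ_ij(p) = 0` and as `+∞` if
`m_ij ≠ 0 = θ_ij(p)`, so that the flux of a pair of finite cost vanishes where `θ_ij(p)` does. -/
def fluxes : Set (PathPair n) :=
  {z | C.IsAntisymm t T z.2 ∧ C.SolvesContinuity t T p₀ z.1 z.2 ∧
    ∀ i j, (i, j) ∈ C.edges →
      (∀ s ∈ Icc t T, C.act θ (z.1 s) i j = 0 → z.2 s i j = 0) ∧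
      IntegrableOn (fun s => C.act θ (z.1 s) i j * L i j (z.2 s i j / C.act θ (z.1 s) i j))
        (Icc t T)}

/-- The payoff in density-flux variables. -/
def fluxPayoff (z : PathPair n) : ℝ :=
  G (z.1 T) - ∫ s in t..T,
    ((1 / 2) * ∑ e ∈ C.edges,
        C.act θ (z.1 s) e.1 e.2 * L e.1 e.2 (z.2 s e.1 e.2 / C.act θ (z.1 s) e.1 e.2)
      - F (z.1 s))

end ReversibleChain

/-- Both components are continuously differentiable on `[t, T]`. -/
def IsC1Pair {n : ℕ} (t T : ℝ) (z : PathPair n) : Prop :=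
  ContDiffOn ℝ 1 z.1 (Icc t T) ∧ ContDiffOn ℝ 1 z.2 (Icc t T)

end

/-! In flux variables the cost of an edge is the perspective `θ L(m/θ)`. It lies above homogeneous
linear functions of `(θ, m)`, touching it, whose coefficient of `θ` is nonpositive
(`exists_tangent`). Hence it is jointly convex and decreasing in `θ`, and it stays convex in `(p,
m)` after a concave activation is inserted. With the linear constraint this gives the convex
problem; dividing a flux by the activation recovers a velocity.

Existence follows the direct method, with strong rather than weak convergence. The perspective is
homogeneous of degree one, hence not strictly convex, so a maximizing sequence need not converge.
Replacing the activation by a constant upper bound gives a smaller cost that is strictly convex and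
superlinear in the flux alone. Almost minimizing it on shrinking superlevel sets of the concave
payoff gives a maximizing sequence with Cauchy fluxes in mean (`exists_maximizing_cauchySeq`).
Fatou's lemma passes to the limit, and superlinearity forces the limit flux to vanish with the
activation (`exists_fluxPayoff_ge_of_tendsto`).

Smooth pairs come from averaging over the past `(s - ε, s]`, after letting the pair rest at `p₀`
before `t`. Looking backwards keeps the initial density, and Jensen's inequality keeps the cost from
growing. For smooth velocities one first mixes in a little of the pair at rest at a positive `p₀`,
so that the activation can be divided out.

For uniqueness, the midpoint of two maximizers is no better than either, so convexity of the cost is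
an equality almost everywhere. Strict convexity of `L` then forces equal velocities wherever one
density is positive (`flux_mul_act_eq`). There the continuity equation with a given velocity is
locally Lipschitz in the density, and a contraction estimate with continuous induction makes the
densities agree. -/

open scoped Topology ENNReal

/-! ### Cost functions and their perspectives -/

noncomputable section

/-- An even, strictly convex, superlinear function on the line vanishing at the origin. -/
structure IsCost (L : ℝ → ℝ) : Prop where
  even : ∀ a, L (-a) = L a
  zero : L 0 = 0
  strictConvex : StrictConvexOn ℝ univ L
  superlinear : Tendsto (fun a => L a / |a|) (cocompact ℝ) atTop

theorem IsLagrangian.isCost {n : ℕ} {C : ReversibleChain n} {L : Fin n → Fin n → ℝ → ℝ}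
    (hL : IsLagrangian C L) {i j : Fin n} (h : (i, j) ∈ C.edges) : IsCost (L i j) :=
  ⟨hL.even i j h, hL.zero i j h, hL.strictConvex i j h, hL.superlinear i j h⟩

/-- The perspective `θ L (m / θ)` of a function `L`; it vanishes for `θ = 0`. -/
def persp (L : ℝ → ℝ) (θ m : ℝ) : ℝ := θ * L (m / θ)

@[simp] theorem persp_zero_left (L : ℝ → ℝ) (m : ℝ) : persp L 0 m = 0 := by simp [persp]

namespace IsCost

variable {L : ℝ → ℝ}

theorem convexOn (hL : IsCost L) : ConvexOn ℝ univ L := hL.strictConvex.convexOn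

theorem continuous (hL : IsCost L) : Continuous L :=
  continuousOn_univ.1 (hL.convexOn.continuousOn isOpen_univ)

theorem nonneg (hL : IsCost L) (a : ℝ) : 0 ≤ L a := by
  have h := hL.convexOn.2 (mem_univ a) (mem_univ (-a)) (by norm_num : (0 : ℝ) ≤ 1 / 2)
    (by norm_num : (0 : ℝ) ≤ 1 / 2) (by norm_num)
  simp only [smul_eq_mul, hL.even] at h
  have e : (1 / 2 : ℝ) * a + 1 / 2 * -a = 0 := by ring
  rw [e, hL.zero] at h
  linarith

/-- The right derivative works: slopes to the left are at most the left derivative, which is at most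
the right derivative, which is at most the slopes to the right. -/
theorem exists_subgradient (hL : IsCost L) (a : ℝ) : ∃ b, ∀ x, L a + b * (x - a) ≤ L x := by
  have hi : a ∈ interior (univ : Set ℝ) := by simp
  refine ⟨derivWithin L (Ioi a) a, fun x => ?_⟩
  rcases lt_trichotomy x a with h | rfl | h
  · have h1 := hL.convexOn.slope_le_leftDeriv_of_mem_interior (mem_univ x) hi h
    have h2 := hL.convexOn.leftDeriv_le_rightDeriv_of_mem_interior hi
    have h3 := h1.trans h2
    rw [slope_def_field, div_le_iff₀ (by linarith)] at h3
    linarith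
  · simp
  · have h1 := hL.convexOn.rightDeriv_le_slope_of_mem_interior hi (mem_univ x) h
    rw [slope_def_field, le_div_iff₀ (by linarith)] at h1
    linarith

theorem persp_nonneg (hL : IsCost L) {θ : ℝ} (hθ : 0 ≤ θ) (m : ℝ) : 0 ≤ persp L θ m :=
  mul_nonneg hθ (hL.nonneg _)

theorem persp_zero_right (hL : IsCost L) (θ : ℝ) : persp L θ 0 = 0 := by simp [persp, hL.zero]

/-- Support planes of the perspective. -/
theorem exists_tangent (hL : IsCost L) (a : ℝ) : ∃ b, L a - b * a ≤ 0 ∧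
    ∀ θ m, 0 ≤ θ → (θ = 0 → m = 0) → θ * (L a - b * a) + b * m ≤ persp L θ m := by
  obtain ⟨b, hb⟩ := hL.exists_subgradient a
  -- The sign of the coefficient of `θ` is the subgradient inequality at the origin, where `L`
  -- vanishes.
  refine ⟨b, by have := hb 0; rw [hL.zero] at this; linarith, fun θ m hθ hm => ?_⟩
  rcases hθ.eq_or_lt with rfl | hθ
  · simp [hm rfl]
  · have h := mul_le_mul_of_nonneg_left (hb (m / θ)) hθ.le
    have e : θ * (m / θ) = m := by field_simp
    have e2 := congrArg (b * ·) e
    beta_reduce at e2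
    unfold persp
    linarith

/-- The support function at the velocity of the combined point is linear, so it can be combined from
the two given points. Its nonpositive coefficient of `θ` makes an inequality for the activations
sufficient, as concavity provides. -/
theorem persp_convex (hL : IsCost L) {θ θ₁ θ₂ m₁ m₂ a b : ℝ} (ha : 0 ≤ a) (hb : 0 ≤ b)
    (h₁ : 0 ≤ θ₁) (h₂ : 0 ≤ θ₂) (hm₁ : θ₁ = 0 → m₁ = 0) (hm₂ : θ₂ = 0 → m₂ = 0)
    (hθ : a * θ₁ + b * θ₂ ≤ θ) :
    persp L θ (a * m₁ + b * m₂) ≤ a * persp L θ₁ m₁ + b * persp L θ₂ m₂ := by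
  have h0 : 0 ≤ θ := le_trans (by positivity) hθ
  rcases h0.eq_or_lt with rfl | h0
  · rw [persp_zero_left]
    have := hL.persp_nonneg h₁ m₁
    have := hL.persp_nonneg h₂ m₂
    positivity
  obtain ⟨c, hc, h⟩ := hL.exists_tangent ((a * m₁ + b * m₂) / θ)
  have t1 := mul_le_mul_of_nonneg_left (h θ₁ m₁ h₁ hm₁) ha
  have t2 := mul_le_mul_of_nonneg_left (h θ₂ m₂ h₂ hm₂) hb
  have e : θ * ((a * m₁ + b * m₂) / θ) = a * m₁ + b * m₂ := by field_simp
  have t3 := mul_le_mul_of_nonpos_right hθ hc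
  rw [persp]
  have e2 := congrArg (c * ·) e
  beta_reduce at e2
  linarith

theorem persp_anti (hL : IsCost L) {θ θ₁ m : ℝ} (h₁ : 0 ≤ θ₁) (hm : θ₁ = 0 → m = 0)
    (hθ : θ₁ ≤ θ) : persp L θ m ≤ persp L θ₁ m := by
  simpa using hL.persp_convex (a := 1) (b := 0) (m₂ := 0) zero_le_one le_rfl h₁ le_rfl hm
    (fun _ => rfl) (by simpa using hθ)

/-- Jensen's inequality for the perspective. -/
theorem persp_integral_le (hL : IsCost L) {α : Type*} [MeasurableSpace α] {μ : Measure α}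
    {θ m : α → ℝ} {θ' : ℝ} (hθ : Integrable θ μ) (hm : Integrable m μ)
    (hf : Integrable (fun r => persp L (θ r) (m r)) μ)
    (h0 : ∀ r, 0 ≤ θ r) (h0m : ∀ r, θ r = 0 → m r = 0) (hle : ∫ r, θ r ∂μ ≤ θ') :
    persp L θ' (∫ r, m r ∂μ) ≤ ∫ r, persp L (θ r) (m r) ∂μ := by
  have hpos : 0 ≤ θ' := (integral_nonneg h0).trans hle
  rcases hpos.eq_or_lt with rfl | hpos
  · rw [persp_zero_left]
    exact integral_nonneg fun r => hL.persp_nonneg (h0 r) _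
  -- The support function has no constant term, so it integrates against any measure, normalized or
  -- not.
  obtain ⟨c, hc, h⟩ := hL.exists_tangent ((∫ r, m r ∂μ) / θ')
  have t1 : ∫ r, (θ r * (L ((∫ r, m r ∂μ) / θ') - c * ((∫ r, m r ∂μ) / θ')) + c * m r) ∂μ ≤
      ∫ r, persp L (θ r) (m r) ∂μ :=
    integral_mono ((hθ.mul_const _).add (hm.const_mul _)) hf fun r => h _ _ (h0 r) (h0m r)
  rw [integral_add (hθ.mul_const _) (hm.const_mul _), integral_mul_const, integral_const_mul] at t1
  have t3 := mul_le_mul_of_nonpos_right hle hc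
  have e : θ' * ((∫ r, m r ∂μ) / θ') = ∫ r, m r ∂μ := by field_simp
  have e2 := congrArg (c * ·) e
  beta_reduce at e2
  rw [persp]
  linarith

/-- Equality in the convexity of the perspective forces equal velocities. -/
theorem mul_eq_mul_of_persp_eq (hL : IsCost L) {θ θ₁ θ₂ m₁ m₂ : ℝ}
    (h₁ : 0 < θ₁) (h₂ : 0 ≤ θ₂) (hm₂ : θ₂ = 0 → m₂ = 0)
    (hθ : 1 / 2 * θ₁ + 1 / 2 * θ₂ ≤ θ)
    (h : persp L θ (1 / 2 * m₁ + 1 / 2 * m₂) = 1 / 2 * persp L θ₁ m₁ + 1 / 2 * persp L θ₂ m₂) :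
    m₂ * θ₁ = θ₂ * m₁ := by
  rcases h₂.eq_or_lt with rfl | h₂
  · simp [hm₂ rfl]
  by_contra hne
  have hv : m₁ / θ₁ ≠ m₂ / θ₂ := by
    intro hv
    rw [div_eq_div_iff h₁.ne' h₂.ne'] at hv
    exact hne (by linarith)
  -- The mean flux over the mean activation is the average of the two velocities with weights
  -- proportional to the activations.
  have hs := hL.strictConvex.2 (mem_univ (m₁ / θ₁)) (mem_univ (m₂ / θ₂)) hv
    (show 0 < θ₁ / (θ₁ + θ₂) by positivity) (show 0 < θ₂ / (θ₁ + θ₂) by positivity)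
    (by field_simp)
  -- Lowering the activation from `θ` to the mean can only raise the cost, which contradicts the
  -- strict inequality `hs`.
  have t := hL.persp_anti (θ₁ := 1 / 2 * θ₁ + 1 / 2 * θ₂) (m := 1 / 2 * m₁ + 1 / 2 * m₂)
    (by positivity) (fun h0 => absurd h0 (by positivity)) hθ
  rw [h] at t
  unfold persp at t
  simp only [smul_eq_mul] at hs
  have e : θ₁ / (θ₁ + θ₂) * (m₁ / θ₁) + θ₂ / (θ₁ + θ₂) * (m₂ / θ₂) =
      (1 / 2 * m₁ + 1 / 2 * m₂) / (1 / 2 * θ₁ + 1 / 2 * θ₂) := by field_simp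
  rw [e] at hs
  have hs' := mul_lt_mul_of_pos_left hs (show 0 < 1 / 2 * θ₁ + 1 / 2 * θ₂ by positivity)
  have e2 : (1 / 2 * θ₁ + 1 / 2 * θ₂) * (θ₁ / (θ₁ + θ₂) * L (m₁ / θ₁) +
      θ₂ / (θ₁ + θ₂) * L (m₂ / θ₂)) =
      1 / 2 * (θ₁ * L (m₁ / θ₁)) + 1 / 2 * (θ₂ * L (m₂ / θ₂)) := by field_simp
  linarith

theorem tendsto_persp (hL : IsCost L) {ι : Type*} {l : Filter ι} {θ m : ι → ℝ} {θ' m' : ℝ}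
    (hθ : Tendsto θ l (𝓝 θ')) (hm : Tendsto m l (𝓝 m')) (h : θ' ≠ 0) :
    Tendsto (fun k => persp L (θ k) (m k)) l (𝓝 (persp L θ' m')) :=
  hθ.mul ((hL.continuous.tendsto _).comp (hm.div hθ h))

/-- With `v = m / θ` the cost is `|m|` times `L v / |v|`. The first factor has a positive limit, and
the second diverges because `|v|` does. This is the limiting form of the value `+∞` for a flux
without activation. -/
theorem tendsto_persp_atTop (hL : IsCost L) {ι : Type*} {l : Filter ι} {θ m : ι → ℝ} {m' : ℝ}
    (hθ : Tendsto θ l (𝓝 0)) (hm : Tendsto m l (𝓝 m')) (h : m' ≠ 0) (h0 : ∀ k, 0 ≤ θ k)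
    (h0m : ∀ k, θ k = 0 → m k = 0) :
    Tendsto (fun k => persp L (θ k) (m k)) l atTop := by
  have hne : ∀ᶠ k in l, m k ≠ 0 := hm.eventually_ne h
  have hθ' : Tendsto θ l (𝓝[>] 0) := by
    refine tendsto_nhdsWithin_iff.2 ⟨hθ, ?_⟩
    filter_upwards [hne] with k hk
    exact lt_of_le_of_ne (h0 k) fun e => hk (h0m k e.symm)
  have ha : Tendsto (fun k => |m k| * (θ k)⁻¹) l atTop :=
    hm.abs.pos_mul_atTop (abs_pos.2 h) hθ'.inv_tendsto_nhdsGT_zero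
  have ha' : Tendsto (fun k => m k / θ k) l (cocompact ℝ) := by
    rw [← Metric.cobounded_eq_cocompact, ← tendsto_norm_atTop_iff_cobounded]
    refine ha.congr fun k => ?_
    rw [Real.norm_eq_abs, abs_div, abs_of_nonneg (h0 k), div_eq_mul_inv]
  have := hm.abs.pos_mul_atTop (abs_pos.2 h) (hL.superlinear.comp ha')
  refine this.congr' ?_
  filter_upwards [hne] with k hk
  have hk' : 0 < θ k := lt_of_le_of_ne (h0 k) fun e => hk (h0m k e.symm)
  simp only [Function.comp, persp, abs_div, abs_of_pos hk']
  have : |m k| ≠ 0 := abs_ne_zero.2 hk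
  field_simp

/-- With the activation frozen the perspective is a cost of the flux alone, strictly convex again;
this supplies the auxiliary functional of the existence proof. -/
theorem persp_isCost (hL : IsCost L) {c : ℝ} (hc : 0 < c) : IsCost (persp L c) where
  even a := by simp [persp, neg_div, hL.even]
  zero := by simp [persp, hL.zero]
  strictConvex := by
    refine ⟨convex_univ, fun x _ y _ hxy a b ha hb hab => ?_⟩
    have h := hL.strictConvex.2 (mem_univ (x / c)) (mem_univ (y / c))
      (fun h => hxy (by field_simp at h; exact h)) ha hb hab
    have e : (a • x + b • y) / c = a • (x / c) + b • (y / c) := by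
      simp only [smul_eq_mul]; ring
    have := mul_lt_mul_of_pos_left h hc
    simp only [persp, e]
    simp only [smul_eq_mul] at this ⊢
    linarith
  superlinear := by
    have h : Tendsto (fun a : ℝ => a / c) (cocompact ℝ) (cocompact ℝ) :=
      (Homeomorph.mulRight₀ c⁻¹ (by positivity)).isClosedEmbedding.tendsto_cocompact
    refine (hL.superlinear.comp h).congr fun a => ?_
    simp only [Function.comp, persp, abs_div, abs_of_pos hc]
    rcases eq_or_ne a 0 with rfl | ha
    · simp
    · have : |a| ≠ 0 := abs_ne_zero.2 ha
      field_simp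

/-- The convexity gap at the midpoint. -/
theorem gap_nonneg (hL : IsCost L) (x y : ℝ) : 0 ≤ L x + L y - 2 * L (1 / 2 * x + 1 / 2 * y) := by
  have h := hL.convexOn.2 (mem_univ x) (mem_univ y) (by norm_num : (0 : ℝ) ≤ 1 / 2)
    (by norm_num : (0 : ℝ) ≤ 1 / 2) (by norm_num)
  simp only [smul_eq_mul] at h
  linarith

theorem gap_pos (hL : IsCost L) {x y : ℝ} (hxy : x ≠ y) :
    0 < L x + L y - 2 * L (1 / 2 * x + 1 / 2 * y) := by
  have h := hL.strictConvex.2 (mem_univ x) (mem_univ y) hxy (by norm_num : (0 : ℝ) < 1 / 2)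
    (by norm_num : (0 : ℝ) < 1 / 2) (by norm_num)
  simp only [smul_eq_mul] at h
  linarith

theorem exists_abs_le (hL : IsCost L) {ε : ℝ} (hε : 0 < ε) :
    ∃ R, 0 < R ∧ ∀ x, R ≤ |x| → |x| ≤ ε * L x := by
  have h := hL.superlinear.eventually (eventually_ge_atTop (1 / ε))
  rw [← Metric.cobounded_eq_cocompact, ← comap_norm_atTop, eventually_comap] at h
  obtain ⟨R, hR⟩ := eventually_atTop.1 h
  refine ⟨max R 1, by positivity, fun x hx => ?_⟩
  have h1 := hR ‖x‖ ((le_max_left _ _).trans hx) x rfl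
  have hx0 : 0 < |x| := lt_of_lt_of_le (by positivity) hx
  rw [div_le_div_iff₀ hε hx0] at h1
  linarith

/-- The distance of two points is controlled by their costs and the convexity gap. -/
theorem exists_abs_sub_le (hL : IsCost L) {ε : ℝ} (hε : 0 < ε) :
    ∃ K, 0 ≤ K ∧ ∀ x y, |x - y| ≤
      ε * (1 + L x + L y) + K * (L x + L y - 2 * L (1 / 2 * x + 1 / 2 * y)) := by
  -- The half is needed when just one point has modulus at least `R`: then `|x - y|` is at most
  -- twice the larger modulus.
  obtain ⟨R, hR, hRL⟩ := hL.exists_abs_le (half_pos hε)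
  let S : Set (ℝ × ℝ) := (Icc (-R) R ×ˢ Icc (-R) R) ∩ {z | ε ≤ |z.1 - z.2|}
  have hS : IsCompact S := (isCompact_Icc.prod isCompact_Icc).inter_right
    (isClosed_le continuous_const (by fun_prop))
  have hcont : Continuous fun z : ℝ × ℝ => L z.1 + L z.2 - 2 * L (1 / 2 * z.1 + 1 / 2 * z.2) := by
    have := hL.continuous
    fun_prop
  -- On bounded pairs at distance at least `ε`, compactness bounds the positive gap away from zero.
  obtain ⟨δ, hδ, hδS⟩ : ∃ δ, 0 < δ ∧ ∀ z ∈ S,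
      δ ≤ L z.1 + L z.2 - 2 * L (1 / 2 * z.1 + 1 / 2 * z.2) := by
    rcases S.eq_empty_or_nonempty with h | h
    · exact ⟨1, one_pos, by simp [h]⟩
    · obtain ⟨z, hz, hmin⟩ := hS.exists_isMinOn h hcont.continuousOn
      refine ⟨_, hL.gap_pos (x := z.1) (y := z.2) fun e => ?_, fun w hw => hmin hw⟩
      have := hz.2
      simp only [mem_ofPred_eq, e, sub_self, abs_zero] at this
      linarith
  -- On `S` the distance is at most `2 * R`, which is this constant times the least gap `δ`.
  refine ⟨2 * R / δ, by positivity, fun x y => ?_⟩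
  have hg := mul_nonneg (show 0 ≤ 2 * R / δ by positivity) (hL.gap_nonneg x y)
  have hx := mul_nonneg hε.le (hL.nonneg x)
  have hy := mul_nonneg hε.le (hL.nonneg y)
  have htri := abs_sub x y
  by_cases hxR : R ≤ |x|
  · by_cases hyR : R ≤ |y|
    · linarith [hRL x hxR, hRL y hyR]
    · linarith [hRL x hxR]
  by_cases hyR : R ≤ |y|
  · linarith [hRL y hyR]
  by_cases hd : ε ≤ |x - y|
  · have h := hδS (x, y) ⟨⟨abs_le.1 (not_le.1 hxR).le, abs_le.1 (not_le.1 hyR).le⟩, hd⟩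
    have h2 := mul_le_mul_of_nonneg_left h (show 0 ≤ 2 * R / δ by positivity)
    have h3 : 2 * R / δ * δ = 2 * R := by field_simp
    simp only at h2
    linarith
  · linarith

end IsCost

/-! ### The graph, the activation and the continuity equation -/

namespace ReversibleChain

variable {n : ℕ} {C : ReversibleChain n} {θ : ℝ → ℝ → ℝ} {L : Fin n → Fin n → ℝ → ℝ}
  {F G : (Fin n → ℝ) → ℝ} {t T : ℝ} {p₀ : Fin n → ℝ}

theorem weight_comm (C : ReversibleChain n) (i j : Fin n) : C.weight i j = C.weight j i :=
  C.detailed_balance i j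

theorem mem_edges {i j : Fin n} : (i, j) ∈ C.edges ↔ i ≠ j ∧ 0 < C.weight i j := by
  simp [edges]

theorem swap_mem_edges {i j : Fin n} (h : (i, j) ∈ C.edges) : (j, i) ∈ C.edges := by
  rw [mem_edges] at h ⊢
  exact ⟨h.1.symm, C.weight_comm i j ▸ h.2⟩

theorem mem_nbhd {i j : Fin n} : j ∈ C.nbhd i ↔ (i, j) ∈ C.edges := by simp [nbhd]

theorem divergence_congr {m m' : Fin n → Fin n → ℝ}
    (h : ∀ i j, (i, j) ∈ C.edges → m i j = m' i j) (i : Fin n) :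
    C.divergence m i = C.divergence m' i :=
  Finset.sum_congr rfl fun j hj => by rw [h i j (mem_nbhd.1 hj)]

theorem divergence_comb (a b : ℝ) (m m' : Fin n → Fin n → ℝ) (i : Fin n) :
    C.divergence (a • m + b • m') i = a * C.divergence m i + b * C.divergence m' i := by
  simp only [divergence, Finset.mul_sum, ← Finset.sum_add_distrib, Pi.add_apply, Pi.smul_apply,
    smul_eq_mul]
  exact Finset.sum_congr rfl fun j _ => by ring

@[simp] theorem divergence_zero (i : Fin n) : C.divergence 0 i = 0 := by simp [divergence]

theorem act_comm (hθ : IsActivation θ) {p : Fin n → ℝ} (hp : p ∈ stdSimplex ℝ (Fin n))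
    (i j : Fin n) : C.act θ p i j = C.act θ p j i :=
  hθ.symm _ _ (div_nonneg (hp.1 i) (C.stat_pos i).le) (div_nonneg (hp.1 j) (C.stat_pos j).le)

theorem act_pos (hθ : IsActivation θ) {p : Fin n → ℝ} (hp : ∀ i, 0 < p i)
    (i j : Fin n) : 0 < C.act θ p i j := by
  have hi := div_pos (hp i) (C.stat_pos i)
  have hj := div_pos (hp j) (C.stat_pos j)
  exact hθ.pos _ _ hi.le hj.le (mul_pos hi hj).ne'

theorem act_nonneg (hθ : IsActivation θ) {p : Fin n → ℝ} (hp : p ∈ stdSimplex ℝ (Fin n))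
    (i j : Fin n) : 0 ≤ C.act θ p i j := by
  have hi := div_nonneg (hp.1 i) (C.stat_pos i).le
  have hj := div_nonneg (hp.1 j) (C.stat_pos j).le
  by_cases h : p i / C.stat i * (p j / C.stat j) = 0
  · exact (hθ.zero _ _ hi hj h).ge
  · exact (hθ.pos _ _ hi hj h).le

theorem concaveOn_act (C : ReversibleChain n)
    (hθc : ConcaveOn ℝ (Ici (0 : ℝ) ×ˢ Ici (0 : ℝ)) (fun z : ℝ × ℝ => θ z.1 z.2))
    (i j : Fin n) : ConcaveOn ℝ (stdSimplex ℝ (Fin n)) fun p => C.act θ p i j := by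
  refine ⟨convex_stdSimplex ℝ _, fun p hp q hq a b ha hb hab => ?_⟩
  have h := hθc.2 (x := (p i / C.stat i, p j / C.stat j)) (y := (q i / C.stat i, q j / C.stat j))
    ⟨div_nonneg (hp.1 i) (C.stat_pos i).le, div_nonneg (hp.1 j) (C.stat_pos j).le⟩
    ⟨div_nonneg (hq.1 i) (C.stat_pos i).le, div_nonneg (hq.1 j) (C.stat_pos j).le⟩ ha hb hab
  have e : ∀ k, (a • p + b • q) k / C.stat k = a * (p k / C.stat k) + b * (q k / C.stat k) := by
    intro k
    simp only [Pi.add_apply, Pi.smul_apply, smul_eq_mul]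
    ring
  simp only [act, e]
  exact h

theorem continuousOn_act (C : ReversibleChain n) (hθ : IsActivation θ) (i j : Fin n) :
    ContinuousOn (fun p => C.act θ p i j) (stdSimplex ℝ (Fin n)) := by
  refine hθ.continuousOn.comp (f := fun p : Fin n → ℝ => (p i / C.stat i, p j / C.stat j))
    (Continuous.continuousOn (by fun_prop)) fun p hp => ?_
  exact ⟨div_nonneg (hp.1 i) (C.stat_pos i).le, div_nonneg (hp.1 j) (C.stat_pos j).le⟩

theorem exists_act_le (C : ReversibleChain n) (hθ : IsActivation θ) :
    ∃ c, 0 < c ∧ ∀ p ∈ stdSimplex ℝ (Fin n), ∀ i j, C.act θ p i j ≤ c := by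
  have h : ∀ e : Fin n × Fin n, ∃ c, ∀ p ∈ stdSimplex ℝ (Fin n), C.act θ p e.1 e.2 ≤ c := by
    intro e
    obtain ⟨c, hc⟩ := (isCompact_stdSimplex ℝ (Fin n)).bddAbove_image (C.continuousOn_act hθ e.1 e.2)
    exact ⟨c, fun p hp => hc (mem_image_of_mem _ hp)⟩
  choose c hc using h
  refine ⟨1 + ∑ e, |c e|, by positivity, fun p hp i j => ?_⟩
  have := Finset.single_le_sum (f := fun e => |c e|) (fun e _ => abs_nonneg _)
    (Finset.mem_univ (i, j))
  have := hc (i, j) p hp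
  have := le_abs_self (c (i, j))
  simp only at *
  linarith

theorem integrableOn_divergence {m : ℝ → Fin n → Fin n → ℝ} {S : Set ℝ}
    (h : ∀ i j, (i, j) ∈ C.edges → IntegrableOn (fun s => m s i j) S) (i : Fin n) :
    IntegrableOn (fun s => C.divergence (m s) i) S :=
  integrable_finsetSum _ fun j hj => (h i j (mem_nbhd.1 hj)).const_mul _

namespace SolvesContinuity

variable {p : ℝ → Fin n → ℝ} {m : ℝ → Fin n → Fin n → ℝ}

theorem intervalIntegrable (h : C.SolvesContinuity t T p₀ p m) {a b : ℝ} (ha : a ∈ Icc t T)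
    (hb : b ∈ Icc t T) (i : Fin n) :
    IntervalIntegrable (fun s => C.divergence (m s) i) volume a b := by
  rw [intervalIntegrable_iff]
  refine (integrableOn_divergence h.integrable i).mono_set ?_
  exact uIoc_subset_uIcc.trans (uIcc_subset_Icc ha hb)

theorem continuousOn (h : C.SolvesContinuity t T p₀ p m) : ContinuousOn p (Icc t T) := by
  rcases lt_or_ge T t with hlt | hle
  · simp [Icc_eq_empty_of_lt hlt]
  refine continuousOn_pi.2 fun i => ?_
  have hc := intervalIntegral.continuousOn_primitive_interval (a := t) (b := T)
    (by rw [uIcc_of_le hle]; exact integrableOn_divergence h.integrable i)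
  rw [uIcc_of_le hle] at hc
  exact (continuousOn_const (c := p₀ i).sub hc).congr fun s hs => h.eqn s hs i

theorem continuousOn_comp (h : C.SolvesContinuity t T p₀ p m) {f : (Fin n → ℝ) → ℝ}
    (hf : ContinuousOn f (stdSimplex ℝ (Fin n))) : ContinuousOn (fun s => f (p s)) (Icc t T) :=
  hf.comp h.continuousOn h.mem_simplex

theorem integrableOn_comp (h : C.SolvesContinuity t T p₀ p m) {f : (Fin n → ℝ) → ℝ}
    (hf : ContinuousOn f (stdSimplex ℝ (Fin n))) : IntegrableOn (fun s => f (p s)) (Icc t T) :=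
  (h.continuousOn_comp hf).integrableOn_Icc

theorem apply_left (h : C.SolvesContinuity t T p₀ p m) (htT : t ≤ T) : p t = p₀ := by
  ext i
  simpa using h.eqn t (left_mem_Icc.2 htT) i

theorem sub_eq (h : C.SolvesContinuity t T p₀ p m) {a b : ℝ} (ha : a ∈ Icc t T)
    (hb : b ∈ Icc t T) (i : Fin n) :
    p b i - p a i = - ∫ s in a..b, C.divergence (m s) i := by
  have ht : t ∈ Icc t T := left_mem_Icc.2 (ha.1.trans ha.2)
  rw [h.eqn a ha, h.eqn b hb, ← intervalIntegral.integral_add_adjacent_intervals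
    (h.intervalIntegrable ht ha i) (h.intervalIntegrable ha hb i)]
  ring

theorem comb (h : C.SolvesContinuity t T p₀ p m) {q : ℝ → Fin n → ℝ}
    {m' : ℝ → Fin n → Fin n → ℝ} (h' : C.SolvesContinuity t T p₀ q m') {a b : ℝ}
    (ha : 0 ≤ a) (hb : 0 ≤ b) (hab : a + b = 1) :
    C.SolvesContinuity t T p₀ (a • p + b • q) (a • m + b • m') where
  mem_simplex s hs := convex_stdSimplex ℝ _ (h.mem_simplex s hs) (h'.mem_simplex s hs) ha hb hab
  integrable i j e := ((h.integrable i j e).const_mul a).add ((h'.integrable i j e).const_mul b)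
  eqn s hs i := by
    have ht : t ∈ Icc t T := left_mem_Icc.2 (hs.1.trans hs.2)
    simp only [Pi.add_apply, Pi.smul_apply, smul_eq_mul, divergence_comb]
    rw [intervalIntegral.integral_add ((h.intervalIntegrable ht hs i).const_mul _)
      ((h'.intervalIntegrable ht hs i).const_mul _), intervalIntegral.integral_const_mul,
      intervalIntegral.integral_const_mul, h.eqn s hs, h'.eqn s hs]
    linear_combination p₀ i * hab

/-- This allows a limit flux to be redefined on a null set of times, where pointwise constraints
could fail. -/
theorem congr_ae (h : C.SolvesContinuity t T p₀ p m) {m' : ℝ → Fin n → Fin n → ℝ}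
    (h' : ∀ᵐ s ∂(volume.restrict (Icc t T)), ∀ i j, (i, j) ∈ C.edges → m s i j = m' s i j) :
    C.SolvesContinuity t T p₀ p m' where
  mem_simplex := h.mem_simplex
  integrable i j e := (h.integrable i j e).congr (h'.mono fun s hs => hs i j e)
  eqn s hs i := by
    rw [h.eqn s hs i]
    congr 1
    refine intervalIntegral.integral_congr_ae_restrict ?_
    rw [uIoc_of_le hs.1]
    refine ae_restrict_of_ae_restrict_of_subset (fun r hr => ?_)
      (h'.mono fun r hr => divergence_congr hr i)
    exact ⟨hr.1.le, hr.2.trans hs.2⟩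

theorem congr (h : C.SolvesContinuity t T p₀ p m) {m' : ℝ → Fin n → Fin n → ℝ}
    (h' : ∀ s ∈ Icc t T, ∀ i j, (i, j) ∈ C.edges → m s i j = m' s i j) :
    C.SolvesContinuity t T p₀ p m' :=
  h.congr_ae ((ae_restrict_iff' measurableSet_Icc).2 (ae_of_all _ h'))

end SolvesContinuity

/-! ### Convexity of the density-flux problem -/

/-- The running cost on an edge. -/
def cost (C : ReversibleChain n) (θ : ℝ → ℝ → ℝ) (L : Fin n → Fin n → ℝ → ℝ) (z : PathPair n)
    (e : Fin n × Fin n) (s : ℝ) : ℝ :=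
  persp (L e.1 e.2) (C.act θ (z.1 s) e.1 e.2) (z.2 s e.1 e.2)

/-- The total cost on an edge. -/
def edgeCost (C : ReversibleChain n) (θ : ℝ → ℝ → ℝ) (L : Fin n → Fin n → ℝ → ℝ) (t T : ℝ)
    (z : PathPair n) (e : Fin n × Fin n) : ℝ :=
  ∫ s in Icc t T, C.cost θ L z e s

theorem mem_fluxes {z : PathPair n} : z ∈ C.fluxes θ L t T p₀ ↔
    C.IsAntisymm t T z.2 ∧ C.SolvesContinuity t T p₀ z.1 z.2 ∧ ∀ e ∈ C.edges,
      (∀ s ∈ Icc t T, C.act θ (z.1 s) e.1 e.2 = 0 → z.2 s e.1 e.2 = 0) ∧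
      IntegrableOn (C.cost θ L z e) (Icc t T) := by
  simp only [fluxes, mem_ofPred_eq, Prod.forall]
  rfl

/-- The standing hypotheses: concave running and final payoffs, a concave activation function,
admissible Lagrangians and an initial density. -/
structure IsControlProblem (C : ReversibleChain n) (θ : ℝ → ℝ → ℝ) (L : Fin n → Fin n → ℝ → ℝ)
    (F G : (Fin n → ℝ) → ℝ) (t T : ℝ) (p₀ : Fin n → ℝ) : Prop where
  isActivation : IsActivation θ
  concaveOn : ConcaveOn ℝ (Ici (0 : ℝ) ×ˢ Ici (0 : ℝ)) (fun z : ℝ × ℝ => θ z.1 z.2)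
  isLagrangian : IsLagrangian C L
  continuousOn_running : ContinuousOn F (stdSimplex ℝ (Fin n))
  concaveOn_running : ConcaveOn ℝ (stdSimplex ℝ (Fin n)) F
  continuousOn_final : ContinuousOn G (stdSimplex ℝ (Fin n))
  concaveOn_final : ConcaveOn ℝ (stdSimplex ℝ (Fin n)) G
  le : t ≤ T
  mem_simplex : p₀ ∈ stdSimplex ℝ (Fin n)

namespace IsControlProblem

theorem isCost (h : C.IsControlProblem θ L F G t T p₀) {e : Fin n × Fin n} (he : e ∈ C.edges) :
    IsCost (L e.1 e.2) := h.isLagrangian.isCost he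

theorem cost_nonneg (h : C.IsControlProblem θ L F G t T p₀) {z : PathPair n} {s : ℝ}
    (hz : z.1 s ∈ stdSimplex ℝ (Fin n)) {e : Fin n × Fin n} (he : e ∈ C.edges) :
    0 ≤ C.cost θ L z e s :=
  (h.isCost he).persp_nonneg (act_nonneg h.isActivation hz _ _) _

theorem edgeCost_nonneg (h : C.IsControlProblem θ L F G t T p₀) {z : PathPair n}
    (hz : z ∈ C.fluxes θ L t T p₀) {e : Fin n × Fin n} (he : e ∈ C.edges) :
    0 ≤ C.edgeCost θ L t T z e :=
  setIntegral_nonneg measurableSet_Icc fun _ hs => h.cost_nonneg (hz.2.1.mem_simplex _ hs) he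

theorem aestronglyMeasurable_cost (h : C.IsControlProblem θ L F G t T p₀) {z : PathPair n}
    (hz : C.SolvesContinuity t T p₀ z.1 z.2) {e : Fin n × Fin n} (he : e ∈ C.edges) :
    AEStronglyMeasurable (C.cost θ L z e) (volume.restrict (Icc t T)) := by
  have h1 : AEMeasurable (fun s => C.act θ (z.1 s) e.1 e.2) (volume.restrict (Icc t T)) :=
    (hz.continuousOn_comp (C.continuousOn_act h.isActivation e.1 e.2)).aemeasurable
      measurableSet_Icc
  have h2 : AEMeasurable (fun s => z.2 s e.1 e.2) (volume.restrict (Icc t T)) :=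
    (hz.integrable e.1 e.2 he).aemeasurable
  exact (h1.mul ((h.isCost he).continuous.measurable.comp_aemeasurable
    (h2.div h1))).aestronglyMeasurable

/-- Rest costs nothing. It shows that the problem is not vacuous, and later pushes densities into
the interior of the simplex. -/
theorem const_mem_fluxes (h : C.IsControlProblem θ L F G t T p₀) :
    ((fun _ => p₀, 0) : PathPair n) ∈ C.fluxes θ L t T p₀ := by
  refine mem_fluxes.2 ⟨fun s _ i j _ => by simp, ⟨fun _ _ => h.mem_simplex, fun i j _ => ?_,
    fun s _ i => by simp⟩, fun e he => ⟨fun _ _ _ => rfl, ?_⟩⟩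
  · exact integrableOn_zero
  · have : C.cost θ L (fun _ => p₀, 0) e = fun _ => 0 := by
      ext s
      simp [cost, (h.isCost he).persp_zero_right]
    rw [this]
    exact integrableOn_zero

theorem fluxPayoff_eq (h : C.IsControlProblem θ L F G t T p₀) {z : PathPair n}
    (hz : z ∈ C.fluxes θ L t T p₀) :
    C.fluxPayoff θ L F G t T z =
      G (z.1 T) - 1 / 2 * ∑ e ∈ C.edges, C.edgeCost θ L t T z e + ∫ s in Icc t T, F (z.1 s) := by
  have hc := (mem_fluxes.1 hz).2.2
  change G (z.1 T) - ∫ s in t..T, ((1 / 2) * ∑ e ∈ C.edges, C.cost θ L z e s - F (z.1 s)) = _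
  rw [intervalIntegral.integral_of_le h.le, ← integral_Icc_eq_integral_Ioc,
    integral_sub ((integrable_finsetSum _ fun e he => (hc e he).2).const_mul _)
      (hz.2.1.integrableOn_comp h.continuousOn_running),
    integral_const_mul, integral_finsetSum _ fun e he => (hc e he).2]
  simp only [edgeCost]
  ring

theorem comb_cost_le (h : C.IsControlProblem θ L F G t T p₀) {z w : PathPair n}
    (hz : z ∈ C.fluxes θ L t T p₀) (hw : w ∈ C.fluxes θ L t T p₀) {a b : ℝ}
    (ha : 0 ≤ a) (hb : 0 ≤ b) (hab : a + b = 1) {e : Fin n × Fin n} (he : e ∈ C.edges)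
    {s : ℝ} (hs : s ∈ Icc t T) :
    C.cost θ L (a • z + b • w) e s ≤ a * C.cost θ L z e s + b * C.cost θ L w e s := by
  have hzs := hz.2.1.mem_simplex s hs
  have hws := hw.2.1.mem_simplex s hs
  exact (h.isCost he).persp_convex ha hb (act_nonneg h.isActivation hzs _ _)
    (act_nonneg h.isActivation hws _ _) ((hz.2.2 _ _ he).1 s hs) ((hw.2.2 _ _ he).1 s hs)
    ((C.concaveOn_act h.concaveOn e.1 e.2).2 hzs hws ha hb hab)

theorem convex_fluxes (h : C.IsControlProblem θ L F G t T p₀) :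
    Convex ℝ (C.fluxes θ L t T p₀) := by
  intro z hz w hw a b ha hb hab
  have hsol : C.SolvesContinuity t T p₀ (a • z + b • w).1 (a • z + b • w).2 :=
    hz.2.1.comb hw.2.1 ha hb hab
  refine mem_fluxes.2 ⟨fun s hs i j he => ?_, hsol, fun e he => ⟨fun s hs h0 => ?_, ?_⟩⟩
  · change a * z.2 s i j + b * w.2 s i j = -(a * z.2 s j i + b * w.2 s j i)
    rw [hz.1 s hs i j he, hw.1 s hs i j he]
    ring
  · have hzs := hz.2.1.mem_simplex s hs
    have hws := hw.2.1.mem_simplex s hs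
    -- If the activation of the mixture vanishes, concavity and nonnegativity make both weighted
    -- activations vanish. In each, the weight or the activation is zero, and in either case the
    -- weighted flux is.
    have hle := (C.concaveOn_act h.concaveOn e.1 e.2).2 hzs hws ha hb hab
    have h1 := act_nonneg (C := C) h.isActivation hzs e.1 e.2
    have h2 := act_nonneg (C := C) h.isActivation hws e.1 e.2
    change C.act θ (a • z.1 s + b • w.1 s) e.1 e.2 = 0 at h0
    simp only [smul_eq_mul, h0] at hle
    have h3 : a * C.act θ (z.1 s) e.1 e.2 = 0 := by nlinarith [mul_nonneg ha h1, mul_nonneg hb h2]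
    have h4 : b * C.act θ (w.1 s) e.1 e.2 = 0 := by nlinarith [mul_nonneg ha h1, mul_nonneg hb h2]
    have h5 : a * z.2 s e.1 e.2 = 0 := by
      rcases mul_eq_zero.1 h3 with h | h
      · simp [h]
      · simp [(hz.2.2 _ _ he).1 s hs h]
    have h6 : b * w.2 s e.1 e.2 = 0 := by
      rcases mul_eq_zero.1 h4 with h | h
      · simp [h]
      · simp [(hw.2.2 _ _ he).1 s hs h]
    change a * z.2 s e.1 e.2 + b * w.2 s e.1 e.2 = 0
    rw [h5, h6, add_zero]
  · refine Integrable.mono' ((((mem_fluxes.1 hz).2.2 e he).2.const_mul a).add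
      (((mem_fluxes.1 hw).2.2 e he).2.const_mul b)) (h.aestronglyMeasurable_cost hsol he) ?_
    refine (ae_restrict_iff' measurableSet_Icc).2 (ae_of_all _ fun s hs => ?_)
    rw [Real.norm_of_nonneg (h.cost_nonneg (hsol.mem_simplex s hs) he)]
    exact h.comb_cost_le hz hw ha hb hab he hs

theorem edgeCost_comb_le (h : C.IsControlProblem θ L F G t T p₀) {z w : PathPair n}
    (hz : z ∈ C.fluxes θ L t T p₀) (hw : w ∈ C.fluxes θ L t T p₀) {a b : ℝ}
    (ha : 0 ≤ a) (hb : 0 ≤ b) (hab : a + b = 1) {e : Fin n × Fin n} (he : e ∈ C.edges) :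
    C.edgeCost θ L t T (a • z + b • w) e ≤
      a * C.edgeCost θ L t T z e + b * C.edgeCost θ L t T w e := by
  have iz := ((mem_fluxes.1 hz).2.2 e he).2
  have iw := ((mem_fluxes.1 hw).2.2 e he).2
  rw [edgeCost, edgeCost, edgeCost, ← integral_const_mul, ← integral_const_mul,
    ← integral_add (iz.const_mul a) (iw.const_mul b)]
  exact setIntegral_mono_on ((mem_fluxes.1 (h.convex_fluxes hz hw ha hb hab)).2.2 e he).2
    ((iz.const_mul a).add (iw.const_mul b)) measurableSet_Icc
    fun s hs => h.comb_cost_le hz hw ha hb hab he hs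

theorem le_integral_running (h : C.IsControlProblem θ L F G t T p₀) {z w : PathPair n}
    (hz : z ∈ C.fluxes θ L t T p₀) (hw : w ∈ C.fluxes θ L t T p₀) {a b : ℝ}
    (ha : 0 ≤ a) (hb : 0 ≤ b) (hab : a + b = 1) :
    a * (∫ s in Icc t T, F (z.1 s)) + b * ∫ s in Icc t T, F (w.1 s) ≤
      ∫ s in Icc t T, F ((a • z + b • w).1 s) := by
  have iz := hz.2.1.integrableOn_comp h.continuousOn_running
  have iw := hw.2.1.integrableOn_comp h.continuousOn_running
  rw [← integral_const_mul, ← integral_const_mul, ← integral_add (iz.const_mul a) (iw.const_mul b)]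
  exact setIntegral_mono_on ((iz.const_mul a).add (iw.const_mul b))
    ((h.convex_fluxes hz hw ha hb hab).2.1.integrableOn_comp h.continuousOn_running)
    measurableSet_Icc fun s hs => h.concaveOn_running.2 (hz.2.1.mem_simplex s hs)
      (hw.2.1.mem_simplex s hs) ha hb hab

theorem le_final (h : C.IsControlProblem θ L F G t T p₀) {z w : PathPair n}
    (hz : z ∈ C.fluxes θ L t T p₀) (hw : w ∈ C.fluxes θ L t T p₀) {a b : ℝ}
    (ha : 0 ≤ a) (hb : 0 ≤ b) (hab : a + b = 1) :
    a * G (z.1 T) + b * G (w.1 T) ≤ G ((a • z + b • w).1 T) :=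
  h.concaveOn_final.2 (hz.2.1.mem_simplex T (right_mem_Icc.2 h.le))
    (hw.2.1.mem_simplex T (right_mem_Icc.2 h.le)) ha hb hab

theorem concaveOn_fluxPayoff (h : C.IsControlProblem θ L F G t T p₀) :
    ConcaveOn ℝ (C.fluxes θ L t T p₀) (C.fluxPayoff θ L F G t T) := by
  refine ⟨h.convex_fluxes, fun z hz w hw a b ha hb hab => ?_⟩
  rw [h.fluxPayoff_eq hz, h.fluxPayoff_eq hw, h.fluxPayoff_eq (h.convex_fluxes hz hw ha hb hab)]
  have h1 := Finset.sum_le_sum fun e he => h.edgeCost_comb_le hz hw ha hb hab (e := e) he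
  rw [Finset.sum_add_distrib, ← Finset.mul_sum, ← Finset.mul_sum] at h1
  have h2 := h.le_integral_running hz hw ha hb hab
  have h3 := h.le_final hz hw ha hb hab
  simp only [smul_eq_mul]
  linarith

/-- Continuity on the compact simplex gives a bound independent of the pair. Since costs are
nonnegative, it makes the value finite and also bounds the costs of nearly optimal pairs. -/
theorem exists_final_add_running_le (h : C.IsControlProblem θ L F G t T p₀) :
    ∃ B, ∀ z ∈ C.fluxes θ L t T p₀, G (z.1 T) + ∫ s in Icc t T, F (z.1 s) ≤ B := by
  obtain ⟨a, ha⟩ := (isCompact_stdSimplex ℝ (Fin n)).bddAbove_image h.continuousOn_running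
  obtain ⟨b, hb⟩ := (isCompact_stdSimplex ℝ (Fin n)).bddAbove_image h.continuousOn_final
  refine ⟨b + ∫ s in Icc t T, a, fun z hz => add_le_add ?_ ?_⟩
  · exact hb (mem_image_of_mem _ (hz.2.1.mem_simplex T (right_mem_Icc.2 h.le)))
  · exact setIntegral_mono_on (hz.2.1.integrableOn_comp h.continuousOn_running)
      (integrableOn_const (by simp)) measurableSet_Icc
      fun s hs => ha (mem_image_of_mem _ (hz.2.1.mem_simplex s hs))

theorem bddAbove_fluxPayoff (h : C.IsControlProblem θ L F G t T p₀) :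
    BddAbove (C.fluxPayoff θ L F G t T '' C.fluxes θ L t T p₀) := by
  obtain ⟨B, hB⟩ := h.exists_final_add_running_le
  refine ⟨B, ?_⟩
  rintro _ ⟨z, hz, rfl⟩
  rw [h.fluxPayoff_eq hz]
  have := hB z hz
  have := Finset.sum_nonneg fun e he => h.edgeCost_nonneg hz (e := e) he
  linarith

/-! ### The change of variables -/

theorem flux_mem_fluxes (h : C.IsControlProblem θ L F G t T p₀) {p : ℝ → Fin n → ℝ}
    {v : ℝ → Fin n → Fin n → ℝ} (hv : (p, v) ∈ C.controls θ L t T p₀) :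
    (p, C.flux θ p v) ∈ C.fluxes θ L t T p₀ ∧
      C.fluxPayoff θ L F G t T (p, C.flux θ p v) = C.controlPayoff θ L F G t T (p, v) := by
  have key : ∀ s i j, C.act θ (p s) i j * L i j (C.flux θ p v s i j / C.act θ (p s) i j) =
      C.act θ (p s) i j * L i j (v s i j) := by
    intro s i j
    by_cases h0 : C.act θ (p s) i j = 0
    · simp [h0]
    · rw [flux, mul_div_cancel_left₀ _ h0]
  refine ⟨⟨fun s hs i j he => ?_, hv.2.1, fun i j he => ⟨fun s _ h0 => ?_, ?_⟩⟩, ?_⟩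
  · change _ * v s i j = -(_ * v s j i)
    rw [act_comm h.isActivation (hv.2.1.mem_simplex s hs), show v s i j = _ from hv.1 s hs i j he]
    ring
  · change _ * _ = _
    rw [h0, zero_mul]
  · simp only [key]
    exact hv.2.2 i j he
  · simp only [fluxPayoff, controlPayoff, key]

/-- The velocity field of a flux. -/
theorem exists_control (h : C.IsControlProblem θ L F G t T p₀) {p : ℝ → Fin n → ℝ}
    {m : ℝ → Fin n → Fin n → ℝ} (hm : (p, m) ∈ C.fluxes θ L t T p₀) :
    (p, fun s i j => m s i j / C.act θ (p s) i j) ∈ C.controls θ L t T p₀ ∧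
      (∀ s ∈ Icc t T, ∀ i j, (i, j) ∈ C.edges →
        m s i j = C.flux θ p (fun s i j => m s i j / C.act θ (p s) i j) s i j) ∧
      C.controlPayoff θ L F G t T (p, fun s i j => m s i j / C.act θ (p s) i j) =
        C.fluxPayoff θ L F G t T (p, m) := by
  have key : ∀ s ∈ Icc t T, ∀ i j, (i, j) ∈ C.edges →
      m s i j = C.flux θ p (fun s i j => m s i j / C.act θ (p s) i j) s i j := by
    intro s hs i j he
    by_cases h0 : C.act θ (p s) i j = 0
    · have : m s i j = 0 := (hm.2.2 i j he).1 s hs h0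
      simp [flux, this]
    · simp only [flux]
      field_simp
  -- Costs and payoffs agree by definition: the quotient chosen as velocity is the argument of `L`
  -- in the flux cost, also where the activation is zero and the quotient is read as zero.
  refine ⟨⟨fun s hs i j he => ?_, hm.2.1.congr key, fun i j he => (hm.2.2 i j he).2⟩, key, rfl⟩
  change m s i j / _ = -(m s j i / _)
  rw [act_comm h.isActivation (hm.2.1.mem_simplex s hs), show m s i j = _ from hm.1 s hs i j he,
    neg_div]

theorem image_controlPayoff (h : C.IsControlProblem θ L F G t T p₀) :
    C.controlPayoff θ L F G t T '' C.controls θ L t T p₀ =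
      C.fluxPayoff θ L F G t T '' C.fluxes θ L t T p₀ := by
  ext x
  constructor
  · rintro ⟨⟨p, v⟩, hv, rfl⟩
    exact ⟨_, (h.flux_mem_fluxes hv).1, (h.flux_mem_fluxes hv).2⟩
  · rintro ⟨⟨p, m⟩, hm, rfl⟩
    exact ⟨_, (h.exists_control hm).1, (h.exists_control hm).2.2⟩

theorem isLUB_fluxPayoff (h : C.IsControlProblem θ L F G t T p₀) :
    IsLUB (C.fluxPayoff θ L F G t T '' C.fluxes θ L t T p₀) (C.value θ L F G t T p₀) := by
  rw [value, h.image_controlPayoff]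
  exact isLUB_csSup ⟨_, mem_image_of_mem _ h.const_mem_fluxes⟩ h.bddAbove_fluxPayoff

end IsControlProblem

end ReversibleChain

/-! ### A maximizing sequence with Cauchy fluxes -/

/-- In a decreasing sequence of convex sets, almost minimizers of a bounded function have
asymptotically vanishing midpoint gap. -/
theorem exists_seq_midpoint_gap_le {E : Type*} [AddCommGroup E] [Module ℝ E] {S : ℕ → Set E}
    (hanti : Antitone S) (hconv : ∀ k, Convex ℝ (S k)) (hne : ∀ k, (S k).Nonempty)
    {J : E → ℝ} {B : ℝ} (h0 : ∀ z ∈ S 0, 0 ≤ J z) (hB : ∀ z ∈ S 0, J z ≤ B) :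
    ∃ z : ℕ → E, (∀ k, z k ∈ S k) ∧ ∀ ε, 0 < ε → ∃ N, ∀ k ≥ N, ∀ l ≥ N,
      J (z k) + J (z l) - 2 * J ((1 / 2 : ℝ) • z k + (1 / 2 : ℝ) • z l) ≤ ε := by
  have hS0 : ∀ k, S k ⊆ S 0 := fun k => hanti (Nat.zero_le k)
  have hbdd : ∀ k, BddBelow (J '' S k) := fun k =>
    ⟨0, by rintro _ ⟨z, hz, rfl⟩; exact h0 z (hS0 k hz)⟩
  let a : ℕ → ℝ := fun k => sInf (J '' S k)
  have hmono : Monotone a := fun k l hkl =>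
    csInf_le_csInf (hbdd k) ((hne l).image J) (image_mono (hanti hkl))
  have hle : ∀ k, ∀ z ∈ S k, a k ≤ J z := fun k z hz => csInf_le (hbdd k) (mem_image_of_mem _ hz)
  have hz : ∀ k : ℕ, ∃ z ∈ S k, J z < a k + 1 / ((k : ℝ) + 1) := fun k => by
    obtain ⟨_, ⟨z, hz, rfl⟩, h⟩ := Real.lt_sInf_add_pos ((hne k).image J)
      (show 0 < 1 / ((k : ℝ) + 1) by positivity)
    exact ⟨z, hz, h⟩
  choose z hz hJ using hz
  refine ⟨z, hz, fun ε hε => ?_⟩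
  have habdd : BddAbove (range a) := by
    refine ⟨B, ?_⟩
    rintro _ ⟨k, rfl⟩
    obtain ⟨w, hw⟩ := hne k
    exact (hle k w hw).trans (hB w (hS0 k hw))
  -- The infima increase to a finite limit `A`, so for large indices all are within `ε / 4` of it.
  have hlim := tendsto_atTop_ciSup hmono habdd
  set A := ⨆ k, a k
  have hAle : ∀ k, a k ≤ A := le_ciSup habdd
  have hev : ∀ᶠ k : ℕ in atTop, A - a k < ε / 4 ∧ 1 / ((k : ℝ) + 1) < ε / 4 := by
    refine Eventually.and ?_ (tendsto_one_div_add_atTop_nhds_zero_nat.eventually_lt_const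
      (by positivity))
    filter_upwards [hlim.eventually_const_lt (show A - ε / 4 < A by linarith)] with k hk
    linarith
  obtain ⟨N, hN⟩ := eventually_atTop.1 hev
  refine ⟨N, fun k hk l hl => ?_⟩
  -- The midpoint lies in the larger set `S N`, so its value is at least `a N`; convexity of `J`
  -- itself plays no role.
  have hmid : (1 / 2 : ℝ) • z k + (1 / 2 : ℝ) • z l ∈ S N :=
    hconv N (hanti hk (hz k)) (hanti hl (hz l)) (by norm_num) (by norm_num) (by norm_num)
  have h1 := hle N _ hmid
  have h2 := hJ k
  have h3 := hJ l
  have h4 := hN k hk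
  have h5 := hN l hl
  have h6 := hN N le_rfl
  linarith [hAle k, hAle l]

/-- A Cauchy sequence of integrable functions converges in mean and, along a subsequence, almost
everywhere. -/
theorem exists_tendsto_of_cauchy_integral {α E : Type*} [MeasurableSpace α] {μ : Measure α}
    [NormedAddCommGroup E] [NormedSpace ℝ E] [CompleteSpace E] {f : ℕ → α → E}
    (hf : ∀ k, Integrable (f k) μ)
    (hc : ∀ ε, 0 < ε → ∃ N, ∀ k ≥ N, ∀ l ≥ N, ∫ x, ‖f k x - f l x‖ ∂μ ≤ ε) :
    ∃ g, Integrable g μ ∧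
      (∀ S, Tendsto (fun k => ∫ x in S, f k x ∂μ) atTop (𝓝 (∫ x in S, g x ∂μ))) ∧
      ∃ φ : ℕ → ℕ, StrictMono φ ∧
        ∀ᵐ x ∂μ, Tendsto (fun k => f (φ k) x) atTop (𝓝 (g x)) := by
  have hcau : CauchySeq fun k => (hf k).toL1 (f k) := by
    refine Metric.cauchySeq_iff.2 fun ε hε => ?_
    obtain ⟨N, hN⟩ := hc (ε / 2) (half_pos hε)
    refine ⟨N, fun k hk l hl => ?_⟩
    rw [dist_eq_norm, ← Integrable.toL1_sub, L1.norm_of_fun_eq_integral_norm]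
    exact (hN k hk l hl).trans_lt (half_lt_self hε)
  obtain ⟨g', hg⟩ := cauchySeq_tendsto_of_complete hcau
  obtain ⟨g, hgi, hlim⟩ : ∃ g : α → E, Integrable g μ ∧
      Tendsto (fun k => eLpNorm (f k - g) 1 μ) atTop (𝓝 0) := by
    refine ⟨_, L1.integrable_coeFn g', ?_⟩
    refine ((Lp.tendsto_Lp_iff_tendsto_eLpNorm' _ _).1 hg).congr fun k => ?_
    exact eLpNorm_congr_ae ((hf k).coeFn_toL1.sub EventuallyEq.rfl)
  refine ⟨g, hgi, fun S => tendsto_setIntegral_of_L1' g hgi.1 (Eventually.of_forall hf) hlim S, ?_⟩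
  exact (tendstoInMeasure_of_tendsto_eLpNorm one_ne_zero (fun k => (hf k).1) hgi.1
    hlim).exists_seq_tendsto_ae

namespace ReversibleChain

variable {n : ℕ} {C : ReversibleChain n} {θ : ℝ → ℝ → ℝ} {L : Fin n → Fin n → ℝ → ℝ}
  {F G : (Fin n → ℝ) → ℝ} {t T : ℝ} {p₀ : Fin n → ℝ}

/-- The values of a field on the edges. -/
def onEdges (C : ReversibleChain n) (m : Fin n → Fin n → ℝ) : Fin n × Fin n → ℝ :=
  fun e => if e ∈ C.edges then m e.1 e.2 else 0

theorem SolvesContinuity.integrable_onEdges {p : ℝ → Fin n → ℝ} {m : ℝ → Fin n → Fin n → ℝ}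
    (h : C.SolvesContinuity t T p₀ p m) :
    IntegrableOn (fun s => C.onEdges (m s)) (Icc t T) := by
  refine Integrable.of_eval fun e => ?_
  by_cases he : e ∈ C.edges
  · simp only [onEdges, he, if_true]
    exact h.integrable _ _ he
  · simp [onEdges, he]

theorem norm_onEdges_sub_le (m m' : Fin n → Fin n → ℝ) :
    ‖C.onEdges m - C.onEdges m'‖ ≤ ∑ e ∈ C.edges, |m e.1 e.2 - m' e.1 e.2| := by
  refine (pi_norm_le_iff_of_nonneg (Finset.sum_nonneg fun _ _ => abs_nonneg _)).2 fun e => ?_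
  by_cases he : e ∈ C.edges
  · simp only [Pi.sub_apply, onEdges, he, if_true, Real.norm_eq_abs]
    exact Finset.single_le_sum (f := fun e : Fin n × Fin n => |m e.1 e.2 - m' e.1 e.2|)
      (fun _ _ => abs_nonneg _) he
  · simp only [Pi.sub_apply, onEdges, he, if_false, sub_self, norm_zero]
    exact Finset.sum_nonneg fun _ _ => abs_nonneg _

namespace IsControlProblem

/-- With a constant activation `c` above all the others the running cost is smaller. -/
theorem persp_const_le_cost (h : C.IsControlProblem θ L F G t T p₀) {c : ℝ}
    (hc : ∀ p ∈ stdSimplex ℝ (Fin n), ∀ i j, C.act θ p i j ≤ c) {z : PathPair n}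
    (hz : z ∈ C.fluxes θ L t T p₀) {e : Fin n × Fin n} (he : e ∈ C.edges) {s : ℝ}
    (hs : s ∈ Icc t T) : persp (L e.1 e.2) c (z.2 s e.1 e.2) ≤ C.cost θ L z e s :=
  (h.isCost he).persp_anti (act_nonneg h.isActivation (hz.2.1.mem_simplex s hs) _ _)
    ((hz.2.2 _ _ he).1 s hs) (hc _ (hz.2.1.mem_simplex s hs) _ _)

theorem integrableOn_persp_const (h : C.IsControlProblem θ L F G t T p₀) {c : ℝ} (hc0 : 0 < c)
    (hc : ∀ p ∈ stdSimplex ℝ (Fin n), ∀ i j, C.act θ p i j ≤ c) {z : PathPair n}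
    (hz : z ∈ C.fluxes θ L t T p₀) {e : Fin n × Fin n} (he : e ∈ C.edges) :
    IntegrableOn (fun s => persp (L e.1 e.2) c (z.2 s e.1 e.2)) (Icc t T) := by
  have hcost := (h.isCost he).persp_isCost hc0
  refine Integrable.mono' ((mem_fluxes.1 hz).2.2 e he).2
    (hcost.continuous.comp_aestronglyMeasurable (hz.2.1.integrable _ _ he).1)
    ((ae_restrict_iff' measurableSet_Icc).2 (ae_of_all _ fun s hs => ?_))
  rw [Real.norm_of_nonneg (hcost.nonneg _)]
  exact h.persp_const_le_cost hc hz he hs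

/-- There is a maximizing sequence whose fluxes form a Cauchy sequence in mean. -/
theorem exists_maximizing_cauchySeq (h : C.IsControlProblem θ L F G t T p₀) :
    ∃ z : ℕ → PathPair n, (∀ k, z k ∈ C.fluxes θ L t T p₀) ∧
      (∀ k : ℕ, C.value θ L F G t T p₀ - 1 / ((k : ℝ) + 1) ≤ C.fluxPayoff θ L F G t T (z k)) ∧
      ∀ ε, 0 < ε → ∃ N, ∀ k ≥ N, ∀ l ≥ N,
        ∫ s in Icc t T, ‖C.onEdges ((z k).2 s) - C.onEdges ((z l).2 s)‖ ≤ ε := by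
  obtain ⟨c, hc0, hc⟩ := C.exists_act_le h.isActivation
  obtain ⟨B, hB⟩ := h.exists_final_add_running_le
  set V := C.value θ L F G t T p₀
  let Φ : Fin n × Fin n → ℝ → ℝ := fun e => persp (L e.1 e.2) c
  have hΦ : ∀ e ∈ C.edges, IsCost (Φ e) := fun e he => (h.isCost he).persp_isCost hc0
  let S : ℕ → Set (PathPair n) := fun k =>
    {z ∈ C.fluxes θ L t T p₀ | V - 1 / ((k : ℝ) + 1) ≤ C.fluxPayoff θ L F G t T z}
  -- This functional sees only the flux and is strictly convex on the edges, unlike the running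
  -- cost.
  let J : PathPair n → ℝ := fun z => ∑ e ∈ C.edges, ∫ s in Icc t T, Φ e (z.2 s e.1 e.2)
  have hint : ∀ z ∈ C.fluxes θ L t T p₀, ∀ e ∈ C.edges,
      IntegrableOn (fun s => Φ e (z.2 s e.1 e.2)) (Icc t T) := fun z hz e he =>
    h.integrableOn_persp_const hc0 hc hz he
  have hnn : ∀ z : PathPair n, ∀ e ∈ C.edges, 0 ≤ ∫ s in Icc t T, Φ e (z.2 s e.1 e.2) :=
    fun z e he => integral_nonneg fun s => (hΦ e he).nonneg _
  -- A payoff of at least `V - 1` leaves at most `B - V + 1` for half the total cost, and `J` is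
  -- below the total cost.
  have hJB : ∀ z ∈ S 0, J z ≤ 2 * (B - V + 1) := by
    rintro z ⟨hz, hzV⟩
    have h1 : J z ≤ ∑ e ∈ C.edges, C.edgeCost θ L t T z e := Finset.sum_le_sum fun e he =>
      setIntegral_mono_on (hint z hz e he) ((mem_fluxes.1 hz).2.2 e he).2 measurableSet_Icc
        fun s hs => h.persp_const_le_cost hc hz he hs
    rw [h.fluxPayoff_eq hz] at hzV
    have h2 := hB z hz
    norm_num at hzV
    linarith
  obtain ⟨z, hz, hgap⟩ := exists_seq_midpoint_gap_le (S := S) (J := J) (B := 2 * (B - V + 1))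
    (fun k l hkl z hz => ⟨hz.1, le_trans (sub_le_sub_left
      (one_div_le_one_div_of_le (by positivity) (by gcongr)) V) hz.2⟩)
    (fun k => h.concaveOn_fluxPayoff.convex_ge _)
    (fun k => by
      obtain ⟨_, ⟨z, hz, rfl⟩, hlt, -⟩ := h.isLUB_fluxPayoff.exists_between
        (show V - 1 / ((k : ℝ) + 1) < V by have : 0 < 1 / ((k : ℝ) + 1) := by positivity
                                           linarith)
      exact ⟨z, hz, hlt.le⟩)
    (fun z hz => Finset.sum_nonneg (hnn z)) hJB
  refine ⟨z, fun k => (hz k).1, fun k => (hz k).2, ?_⟩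
  have hz0 : ∀ k, z k ∈ S 0 := fun k => ⟨(hz k).1, le_trans (sub_le_sub_left
      (one_div_le_one_div_of_le (by positivity) (by simp)) V) (hz k).2⟩
  have hedge : ∀ e ∈ C.edges, ∀ ε, 0 < ε → ∃ N, ∀ k ≥ N, ∀ l ≥ N,
      ∫ s in Icc t T, |(z k).2 s e.1 e.2 - (z l).2 s e.1 e.2| ≤ ε := by
    intro e he ε hε
    have hD : 0 ≤ T - t := sub_nonneg.2 h.le
    have hB0 : 0 ≤ 2 * (B - V + 1) :=
      (Finset.sum_nonneg (hnn (z 0))).trans (hJB (z 0) (hz0 0))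
    -- `D` bounds the integral of `1 + Φ + Φ` along the sequence, so the weight `ε / (2 * D)`
    -- contributes at most `ε / 2`; the gap bound `ε / (2 * (K + 1))` handles the other half.
    set D := T - t + 2 * (2 * (B - V + 1)) + 1
    have hDpos : 0 < D := by positivity
    obtain ⟨K, hK0, hK⟩ := (hΦ e he).exists_abs_sub_le (ε := ε / (2 * D)) (by positivity)
    obtain ⟨N, hN⟩ := hgap (ε / (2 * (K + 1))) (by positivity)
    refine ⟨N, fun k hk l hl => ?_⟩
    have hmid : (1 / 2 : ℝ) • z k + (1 / 2 : ℝ) • z l ∈ C.fluxes θ L t T p₀ :=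
      h.convex_fluxes (hz k).1 (hz l).1 (by norm_num) (by norm_num) (by norm_num)
    let w := (1 / 2 : ℝ) • z k + (1 / 2 : ℝ) • z l
    have hwe : ∀ e : Fin n × Fin n, ∀ s, w.2 s e.1 e.2 =
      1 / 2 * (z k).2 s e.1 e.2 + 1 / 2 * (z l).2 s e.1 e.2 := fun _ _ => rfl
    let I : PathPair n → Fin n × Fin n → ℝ := fun z e => ∫ s in Icc t T, Φ e (z.2 s e.1 e.2)
    have hI : ∀ e ∈ C.edges, I (z k) e + I (z l) e - 2 * I w e =
        ∫ s in Icc t T, (Φ e ((z k).2 s e.1 e.2) + Φ e ((z l).2 s e.1 e.2) -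
          2 * Φ e (1 / 2 * (z k).2 s e.1 e.2 + 1 / 2 * (z l).2 s e.1 e.2)) := by
      intro e he
      have i1 := hint _ (hz k).1 e he
      have i2 := hint _ (hz l).1 e he
      have i3 := (hint w hmid e he).const_mul 2
      have i12 : IntegrableOn
          (fun s => Φ e ((z k).2 s e.1 e.2) + Φ e ((z l).2 s e.1 e.2)) (Icc t T) := i1.add i2
      simp only [I, hwe] at i3 ⊢
      rw [integral_sub i12 i3, integral_add i1 i2, integral_const_mul]
    have hgap_e : I (z k) e + I (z l) e - 2 * I w e ≤ ε / (2 * (K + 1)) := by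
      have h1 : J (z k) + J (z l) - 2 * J w =
          ∑ e ∈ C.edges, (I (z k) e + I (z l) e - 2 * I w e) := by
        simp only [J, I, Finset.sum_sub_distrib, Finset.sum_add_distrib, Finset.mul_sum]
      refine le_trans ?_ (hN k hk l hl)
      rw [h1]
      -- Each edge has a nonnegative gap, so the total gap controls every single one.
      refine Finset.single_le_sum (f := fun e => I (z k) e + I (z l) e - 2 * I w e)
        (fun e he => ?_) he
      rw [hI e he]
      exact integral_nonneg fun s => (hΦ e he).gap_nonneg _ _
    have hIle : ∀ k, I (z k) e ≤ 2 * (B - V + 1) := fun k =>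
      (Finset.single_le_sum (f := I (z k)) (hnn (z k)) he).trans (hJB _ (hz0 k))
    have i1 := hint _ (hz k).1 e he
    have i2 := hint _ (hz l).1 e he
    have i3 := (hint w hmid e he).const_mul 2
    have ic : IntegrableOn (fun _ : ℝ => (1 : ℝ)) (Icc t T) := integrableOn_const (by simp)
    simp only [hwe] at i3
    have ic1 : IntegrableOn (fun s => 1 + Φ e ((z k).2 s e.1 e.2)) (Icc t T) := ic.add i1
    have ig : IntegrableOn (fun s => Φ e ((z k).2 s e.1 e.2) + Φ e ((z l).2 s e.1 e.2) -
        2 * Φ e (1 / 2 * (z k).2 s e.1 e.2 + 1 / 2 * (z l).2 s e.1 e.2)) (Icc t T) :=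
      (i1.add i2).sub i3
    have ip : IntegrableOn (fun s => 1 + Φ e ((z k).2 s e.1 e.2) + Φ e ((z l).2 s e.1 e.2))
        (Icc t T) := ic1.add i2
    have hmain : ∫ s in Icc t T, |(z k).2 s e.1 e.2 - (z l).2 s e.1 e.2| ≤
        ε / (2 * D) * (T - t + I (z k) e + I (z l) e) +
          K * (I (z k) e + I (z l) e - 2 * I w e) := by
      have h2 : ∫ s in Icc t T, |(z k).2 s e.1 e.2 - (z l).2 s e.1 e.2| ≤ ∫ s in Icc t T,
          (ε / (2 * D) * (1 + Φ e ((z k).2 s e.1 e.2) + Φ e ((z l).2 s e.1 e.2)) +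
          K * (Φ e ((z k).2 s e.1 e.2) + Φ e ((z l).2 s e.1 e.2) -
          2 * Φ e (1 / 2 * (z k).2 s e.1 e.2 + 1 / 2 * (z l).2 s e.1 e.2))) :=
        integral_mono (((hz k).1.2.1.integrable _ _ he).sub ((hz l).1.2.1.integrable _ _ he)).abs
          ((ip.const_mul _).add (ig.const_mul _))
          fun s => hK _ _
      rw [integral_add (ip.const_mul _) (ig.const_mul _),
        integral_const_mul, integral_const_mul, ← hI e he, integral_add ic1 i2,
        integral_add ic i1] at h2
      simpa [I, h.le] using h2
    have h3 : T - t + I (z k) e + I (z l) e ≤ D := by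
      have := hIle k
      have := hIle l
      simp only [D]
      linarith
    have h4 : ε / (2 * D) * (T - t + I (z k) e + I (z l) e) ≤ ε / 2 := by
      refine (mul_le_mul_of_nonneg_left h3 (by positivity)).trans_eq ?_
      field_simp
    have h5 : K * (I (z k) e + I (z l) e - 2 * I w e) ≤ ε / 2 := by
      refine (mul_le_mul_of_nonneg_left hgap_e hK0).trans ?_
      rw [mul_div_assoc', div_le_div_iff₀ (by positivity) (by positivity)]
      nlinarith
    linarith
  intro ε hε
  have hε' : 0 < ε / (C.edges.card + 1) := by positivity
  choose! N hN using fun e (he : e ∈ C.edges) => hedge e he _ hε'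
  refine ⟨C.edges.sup N, fun k hk l hl => ?_⟩
  have hi : ∀ e ∈ C.edges, IntegrableOn
      (fun s => |(z k).2 s e.1 e.2 - (z l).2 s e.1 e.2|) (Icc t T) := fun e he =>
    (((hz k).1.2.1.integrable _ _ he).sub ((hz l).1.2.1.integrable _ _ he)).abs
  calc ∫ s in Icc t T, ‖C.onEdges ((z k).2 s) - C.onEdges ((z l).2 s)‖
      ≤ ∫ s in Icc t T, ∑ e ∈ C.edges, |(z k).2 s e.1 e.2 - (z l).2 s e.1 e.2| :=
        integral_mono ((hz k).1.2.1.integrable_onEdges.sub (hz l).1.2.1.integrable_onEdges).norm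
          (integrable_finsetSum _ hi) fun s => norm_onEdges_sub_le _ _
    _ = ∑ e ∈ C.edges, ∫ s in Icc t T, |(z k).2 s e.1 e.2 - (z l).2 s e.1 e.2| :=
        integral_finsetSum _ hi
    _ ≤ ∑ e ∈ C.edges, ε / (C.edges.card + 1) := Finset.sum_le_sum fun e he =>
        hN e he k ((Finset.le_sup he).trans hk) l ((Finset.le_sup he).trans hl)
    _ ≤ ε := by
        rw [Finset.sum_const, nsmul_eq_mul, mul_div_assoc', div_le_iff₀ (by positivity)]
        nlinarith

end IsControlProblem

/-! ### Passage to the limit and existence of a maximizer -/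

theorem divergence_eq_sum_onEdges (m : Fin n → Fin n → ℝ) (i : Fin n) :
    C.divergence m i = ∑ j ∈ C.nbhd i, √(C.weight i j) * C.onEdges m (i, j) :=
  Finset.sum_congr rfl fun j hj => by simp [onEdges, mem_nbhd.1 hj]

/-- The divergence integrates componentwise. -/
theorem integral_divergence {m : ℝ → Fin n → Fin n → ℝ} {S : Set ℝ}
    (hm : IntegrableOn (fun s => C.onEdges (m s)) S) (i : Fin n) :
    ∫ s in S, C.divergence (m s) i =
      ∑ j ∈ C.nbhd i, √(C.weight i j) * (∫ s in S, C.onEdges (m s)) (i, j) := by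
  simp only [divergence_eq_sum_onEdges]
  rw [integral_finsetSum _ fun j _ => (hm.eval (i, j)).const_mul _]
  refine Finset.sum_congr rfl fun j _ => ?_
  rw [integral_const_mul, eval_integral fun e => hm.eval e]

namespace IsControlProblem

/-- Fatou's lemma is applied in extended nonnegative form; this translates the total cost there and
back. -/
theorem lintegral_cost (h : C.IsControlProblem θ L F G t T p₀) {z : PathPair n}
    (hz : z ∈ C.fluxes θ L t T p₀) :
    ∫⁻ s in Icc t T, ∑ e ∈ C.edges, ENNReal.ofReal (C.cost θ L z e s) =
      ENNReal.ofReal (∑ e ∈ C.edges, C.edgeCost θ L t T z e) := by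
  rw [lintegral_finsetSum' _ fun e he =>
      ((mem_fluxes.1 hz).2.2 e he).2.aemeasurable.ennreal_ofReal,
    ENNReal.ofReal_sum_of_nonneg fun e he => h.edgeCost_nonneg hz he]
  refine Finset.sum_congr rfl fun e he => ?_
  refine (ofReal_integral_eq_lintegral_ofReal ((mem_fluxes.1 hz).2.2 e he).2 ?_).symm
  exact (ae_restrict_iff' measurableSet_Icc).2
    (ae_of_all _ fun s hs => h.cost_nonneg (hz.2.1.mem_simplex s hs) he)

/-- The running cost is lower semicontinuous. -/
theorem sum_ofReal_cost_le_liminf (h : C.IsControlProblem θ L F G t T p₀) {z : ℕ → PathPair n}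
    {w : PathPair n} {s : ℝ} (hz : ∀ k, (z k).1 s ∈ stdSimplex ℝ (Fin n))
    (hp : Tendsto (fun k => (z k).1 s) atTop (𝓝 (w.1 s)))
    (hm : ∀ e ∈ C.edges, Tendsto (fun k => (z k).2 s e.1 e.2) atTop (𝓝 (w.2 s e.1 e.2))) :
    ∑ e ∈ C.edges, ENNReal.ofReal (C.cost θ L w e s) ≤
      liminf (fun k => ∑ e ∈ C.edges, ENNReal.ofReal (C.cost θ L (z k) e s)) atTop := by
  have hw : w.1 s ∈ stdSimplex ℝ (Fin n) :=
    (isClosed_stdSimplex ℝ (Fin n)).mem_of_tendsto hp (Eventually.of_forall hz)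
  have hact : ∀ e : Fin n × Fin n, Tendsto (fun k => C.act θ ((z k).1 s) e.1 e.2) atTop
      (𝓝 (C.act θ (w.1 s) e.1 e.2)) := fun e =>
    (C.continuousOn_act h.isActivation e.1 e.2 _ hw).tendsto.comp
      (tendsto_nhdsWithin_iff.2 ⟨hp, Eventually.of_forall hz⟩)
  classical
  -- Edges whose limit activation vanishes add nothing to the limit cost and may be dropped from the
  -- sequence; on the others the perspective is continuous.
  let E := C.edges.filter fun e => C.act θ (w.1 s) e.1 e.2 ≠ 0
  have h1 : ∑ e ∈ C.edges, ENNReal.ofReal (C.cost θ L w e s) =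
      ∑ e ∈ E, ENNReal.ofReal (C.cost θ L w e s) := by
    refine (Finset.sum_subset (Finset.filter_subset _ _) fun e he he' => ?_).symm
    have : C.act θ (w.1 s) e.1 e.2 = 0 := by
      by_contra h0
      exact he' (Finset.mem_filter.2 ⟨he, h0⟩)
    simp [cost, this]
  have h2 : Tendsto (fun k => ∑ e ∈ E, ENNReal.ofReal (C.cost θ L (z k) e s)) atTop
      (𝓝 (∑ e ∈ E, ENNReal.ofReal (C.cost θ L w e s))) :=
    tendsto_finsetSum _ fun e he => ENNReal.tendsto_ofReal
      ((h.isCost (Finset.mem_filter.1 he).1).tendsto_persp (hact e)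
        (hm e (Finset.mem_filter.1 he).1) (Finset.mem_filter.1 he).2)
  rw [h1, ← h2.liminf_eq]
  exact liminf_le_liminf (Eventually.of_forall fun k =>
    Finset.sum_le_sum_of_subset (Finset.filter_subset _ _))

/-- Where the limit of the running costs is finite, the limit flux vanishes with the activation. -/
theorem flux_eq_zero_of_liminf_lt_top (h : C.IsControlProblem θ L F G t T p₀)
    {z : ℕ → PathPair n} {s : ℝ} (hs : s ∈ Icc t T) (hz : ∀ k, z k ∈ C.fluxes θ L t T p₀)
    {p : Fin n → ℝ} {m : Fin n → Fin n → ℝ}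
    (hp : Tendsto (fun k => (z k).1 s) atTop (𝓝 p)) {e : Fin n × Fin n} (he : e ∈ C.edges)
    (hm : Tendsto (fun k => (z k).2 s e.1 e.2) atTop (𝓝 (m e.1 e.2)))
    (hfin : liminf (fun k => ∑ e ∈ C.edges, ENNReal.ofReal (C.cost θ L (z k) e s)) atTop < ⊤)
    (h0 : C.act θ p e.1 e.2 = 0) : m e.1 e.2 = 0 := by
  by_contra hne
  have hzs : ∀ k, (z k).1 s ∈ stdSimplex ℝ (Fin n) := fun k => (hz k).2.1.mem_simplex s hs
  have hw : p ∈ stdSimplex ℝ (Fin n) :=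
    (isClosed_stdSimplex ℝ (Fin n)).mem_of_tendsto hp (Eventually.of_forall hzs)
  have hact : Tendsto (fun k => C.act θ ((z k).1 s) e.1 e.2) atTop (𝓝 0) := h0 ▸
    (C.continuousOn_act h.isActivation e.1 e.2 _ hw).tendsto.comp
      (tendsto_nhdsWithin_iff.2 ⟨hp, Eventually.of_forall hzs⟩)
  have h1 := ENNReal.tendsto_ofReal_atTop.comp ((h.isCost he).tendsto_persp_atTop hact hm hne
    (fun k => act_nonneg h.isActivation (hzs k) _ _) fun k => ((hz k).2.2 _ _ he).1 s hs)
  refine hfin.not_ge (h1.liminf_eq.ge.trans (liminf_le_liminf (Eventually.of_forall fun k => ?_)))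
  exact Finset.single_le_sum (f := fun e => ENNReal.ofReal (C.cost θ L (z k) e s))
    (fun _ _ => zero_le) he

/-- The payoff is upper semicontinuous along fluxes that converge in mean and almost everywhere. -/
theorem exists_fluxPayoff_ge_of_tendsto (h : C.IsControlProblem θ L F G t T p₀)
    {z : ℕ → PathPair n} (hz : ∀ k, z k ∈ C.fluxes θ L t T p₀) {c : ℕ → ℝ} {V : ℝ}
    (hc : Tendsto c atTop (𝓝 V)) (hcz : ∀ k, c k ≤ C.fluxPayoff θ L F G t T (z k))
    {g : ℝ → Fin n × Fin n → ℝ} (hg : IntegrableOn g (Icc t T))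
    (hlim : ∀ S ⊆ Icc t T, Tendsto (fun k => ∫ s in S, C.onEdges ((z k).2 s)) atTop
      (𝓝 (∫ s in S, g s)))
    (hae : ∀ᵐ s ∂(volume.restrict (Icc t T)),
      Tendsto (fun k => C.onEdges ((z k).2 s)) atTop (𝓝 (g s))) :
    ∃ w ∈ C.fluxes θ L t T p₀, V ≤ C.fluxPayoff θ L F G t T w := by
  classical
  let m : ℝ → Fin n → Fin n → ℝ := fun s i j => if (i, j) ∈ C.edges then g s (i, j) else 0
  have hmg : ∀ s, ∀ e ∈ C.edges, m s e.1 e.2 = g s e := fun s e he => if_pos he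
  -- The limit density is built from the limit flux. Convergence of the flux integrals over `(t, s]`
  -- makes the densities converge at every time `s`.
  let p : ℝ → Fin n → ℝ := fun s i => p₀ i - ∫ r in t..s, C.divergence (m r) i
  have hmi : ∀ i j, (i, j) ∈ C.edges → IntegrableOn (fun s => m s i j) (Icc t T) := fun i j he =>
    (Integrable.eval hg (i, j)).congr (ae_of_all _ fun s => (hmg s (i, j) he).symm)
  have hge : ∀ s, ∀ e ∈ C.edges, C.onEdges (m s) e = g s e := fun s e he => by
    simp only [onEdges, he, if_true, hmg]
  have hp : ∀ s ∈ Icc t T, Tendsto (fun k => (z k).1 s) atTop (𝓝 (p s)) := by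
    intro s hs
    refine tendsto_pi_nhds.2 fun i => ?_
    have hsub : Ioc t s ⊆ Icc t T := fun r hr => ⟨hr.1.le, hr.2.trans hs.2⟩
    have h1 : ∀ k, (z k).1 s i = p₀ i -
        ∑ j ∈ C.nbhd i, √(C.weight i j) * (∫ s in Ioc t s, C.onEdges ((z k).2 s)) (i, j) := by
      intro k
      rw [(hz k).2.1.eqn s hs, intervalIntegral.integral_of_le hs.1,
        integral_divergence ((hz k).2.1.integrable_onEdges.mono_set hsub)]
    have h2 : p s i = p₀ i -
        ∑ j ∈ C.nbhd i, √(C.weight i j) * (∫ s in Ioc t s, g s) (i, j) := by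
      have hg' := hg.mono_set hsub
      simp only [p]
      rw [intervalIntegral.integral_of_le hs.1]
      simp only [divergence]
      rw [integral_finsetSum _ fun j hj =>
        ((hmi i j (mem_nbhd.1 hj)).mono_set hsub).const_mul _]
      congr 1
      refine Finset.sum_congr rfl fun j hj => ?_
      rw [integral_const_mul, eval_integral fun e => Integrable.eval hg' e]
      simp only [hmg _ (i, j) (mem_nbhd.1 hj)]
    simp only [h1, h2]
    exact tendsto_const_nhds.sub (tendsto_finsetSum _ fun j _ =>
      ((tendsto_pi_nhds.1 (hlim _ hsub) (i, j)).const_mul _))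
  have hps : ∀ s ∈ Icc t T, p s ∈ stdSimplex ℝ (Fin n) := fun s hs =>
    (isClosed_stdSimplex ℝ (Fin n)).mem_of_tendsto (hp s hs)
      (Eventually.of_forall fun k => (hz k).2.1.mem_simplex s hs)
  have hsol : C.SolvesContinuity t T p₀ p m := ⟨hps, hmi, fun _ _ _ => rfl⟩
  have hcomp : ∀ f : (Fin n → ℝ) → ℝ, ContinuousOn f (stdSimplex ℝ (Fin n)) → ∀ s ∈ Icc t T,
      Tendsto (fun k => f ((z k).1 s)) atTop (𝓝 (f (p s))) := fun f hf s hs =>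
    (hf _ (hps s hs)).tendsto.comp (tendsto_nhdsWithin_iff.2 ⟨hp s hs,
      Eventually.of_forall fun k => (hz k).2.1.mem_simplex s hs⟩)
  have hFlim : Tendsto (fun k => ∫ s in Icc t T, F ((z k).1 s)) atTop
      (𝓝 (∫ s in Icc t T, F (p s))) := by
    obtain ⟨b, hb⟩ := (isCompact_stdSimplex ℝ (Fin n)).exists_bound_of_continuousOn
      h.continuousOn_running
    refine tendsto_integral_of_dominated_convergence (fun _ => b)
      (fun k => ((hz k).2.1.integrableOn_comp h.continuousOn_running).1)
      (integrableOn_const (by simp)) (fun k => ?_) ?_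
    · exact (ae_restrict_iff' measurableSet_Icc).2
        (ae_of_all _ fun s hs => hb _ ((hz k).2.1.mem_simplex s hs))
    · exact (ae_restrict_iff' measurableSet_Icc).2
        (ae_of_all _ fun s hs => hcomp F h.continuousOn_running s hs)
  -- `R` is the limit of the bounds that the payoffs `c k` impose on the total costs; the factor
  -- undoes the one half in the payoff.
  set R := 2 * (G (p T) + (∫ s in Icc t T, F (p s)) - V)
  have hRlim : Tendsto (fun k => 2 * (G ((z k).1 T) + (∫ s in Icc t T, F ((z k).1 s)) - c k))
      atTop (𝓝 R) :=
    (((hcomp G h.continuousOn_final T (right_mem_Icc.2 h.le)).add hFlim).sub hc).const_mul 2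
  have hRle : ∀ k, ∑ e ∈ C.edges, C.edgeCost θ L t T (z k) e ≤
      2 * (G ((z k).1 T) + (∫ s in Icc t T, F ((z k).1 s)) - c k) := by
    intro k
    have := hcz k
    rw [h.fluxPayoff_eq (hz k)] at this
    linarith
  have hR0 : 0 ≤ R := ge_of_tendsto' hRlim fun k =>
    (Finset.sum_nonneg fun e he => h.edgeCost_nonneg (hz k) he).trans (hRle k)
  have hfatou : ∫⁻ s in Icc t T,
      liminf (fun k => ∑ e ∈ C.edges, ENNReal.ofReal (C.cost θ L (z k) e s)) atTop ≤
        ENNReal.ofReal R := by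
    refine (lintegral_liminf_le' fun k => Finset.aemeasurable_fun_sum _ fun e he =>
      ((mem_fluxes.1 (hz k)).2.2 e he).2.aemeasurable.ennreal_ofReal).trans ?_
    rw [← (ENNReal.tendsto_ofReal hRlim).liminf_eq]
    refine liminf_le_liminf (Eventually.of_forall fun k => ?_)
    simp only [h.lintegral_cost (hz k)]
    exact ENNReal.ofReal_le_ofReal (hRle k)
  have hfin : ∀ᵐ s ∂(volume.restrict (Icc t T)),
      liminf (fun k => ∑ e ∈ C.edges, ENNReal.ofReal (C.cost θ L (z k) e s)) atTop < ⊤ :=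
    ae_lt_top' (by
      simp only [liminf_eq_iSup_iInf_of_nat']
      exact .iSup fun _ => .iInf fun _ => Finset.aemeasurable_fun_sum _ fun e he =>
        ((mem_fluxes.1 (hz _)).2.2 e he).2.aemeasurable.ennreal_ofReal)
      (hfatou.trans_lt ENNReal.ofReal_lt_top).ne
  let good : ℝ → Prop := fun s => ∀ e ∈ C.edges,
    Tendsto (fun k => (z k).2 s e.1 e.2) atTop (𝓝 (m s e.1 e.2)) ∧
      (C.act θ (p s) e.1 e.2 = 0 → m s e.1 e.2 = 0)
  have hgood : ∀ᵐ s ∂(volume.restrict (Icc t T)), s ∈ Icc t T ∧ good s := by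
    filter_upwards [hae, hfin, ae_restrict_mem measurableSet_Icc] with s h1 h2 hs
    refine ⟨hs, fun e he => ?_⟩
    have h3 : Tendsto (fun k => (z k).2 s e.1 e.2) atTop (𝓝 (m s e.1 e.2)) := by
      have := tendsto_pi_nhds.1 h1 e
      simpa only [onEdges, he, if_true, ← hmg s e he] using this
    exact ⟨h3, h.flux_eq_zero_of_liminf_lt_top hs hz (hp s hs) he h3 h2⟩
  -- Feasibility asks for antisymmetry and vanishing flux at every time, so the flux is set to zero
  -- at the null set of exceptional times.
  let w : PathPair n := (p, fun s i j => if good s then m s i j else 0)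
  have hwm : ∀ s, good s → w.2 s = m s := fun s hs => by
    ext i j
    simp [w, hs]
  have hw0 : ∀ s, ¬ good s → w.2 s = 0 := fun s hs => by
    ext i j
    simp [w, hs]
  have hwsol : C.SolvesContinuity t T p₀ w.1 w.2 :=
    hsol.congr_ae (hgood.mono fun s hs i j _ => by rw [hwm s hs.2])
  have hcost : ∫⁻ s in Icc t T, ∑ e ∈ C.edges, ENNReal.ofReal (C.cost θ L w e s) ≤
      ENNReal.ofReal R := by
    refine (lintegral_mono_ae ?_).trans hfatou
    filter_upwards [hgood] with s hs
    refine h.sum_ofReal_cost_le_liminf (fun k => (hz k).2.1.mem_simplex s hs.1) (hp s hs.1) ?_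
    rw [hwm s hs.2]
    exact fun e he => (hs.2 e he).1
  have hw : w ∈ C.fluxes θ L t T p₀ := by
    refine mem_fluxes.2 ⟨fun s hs i j he => ?_, hwsol, fun e he => ⟨fun s hs h0 => ?_, ?_⟩⟩
    · by_cases hgs : good s
      · rw [hwm s hgs]
        refine tendsto_nhds_unique (hgs (i, j) he).1
          ((hgs (j, i) (swap_mem_edges he)).1.neg.congr fun k => ?_)
        exact ((hz k).1 s hs i j he).symm
      · simp [hw0 s hgs]
    · by_cases hgs : good s
      · rw [hwm s hgs]
        exact (hgs e he).2 h0
      · simp [hw0 s hgs]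
    · refine (lintegral_ofReal_ne_top_iff_integrable (h.aestronglyMeasurable_cost hwsol he)
        ((ae_restrict_iff' measurableSet_Icc).2 (ae_of_all _ fun s hs =>
          h.cost_nonneg (hwsol.mem_simplex s hs) he))).1 (ne_top_of_le_ne_top
          (hcost.trans_lt ENNReal.ofReal_lt_top).ne (lintegral_mono fun s => ?_))
      exact Finset.single_le_sum (f := fun e => ENNReal.ofReal (C.cost θ L w e s))
        (fun _ _ => zero_le) he
  refine ⟨w, hw, ?_⟩
  rw [h.lintegral_cost hw, ENNReal.ofReal_le_ofReal_iff hR0] at hcost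
  rw [h.fluxPayoff_eq hw]
  change V ≤ G (p T) - _ + ∫ s in Icc t T, F (p s)
  linarith

theorem isGreatest_fluxPayoff (h : C.IsControlProblem θ L F G t T p₀) :
    IsGreatest (C.fluxPayoff θ L F G t T '' C.fluxes θ L t T p₀) (C.value θ L F G t T p₀) := by
  refine ⟨?_, h.isLUB_fluxPayoff.1⟩
  obtain ⟨z, hz, hV, hcau⟩ := h.exists_maximizing_cauchySeq
  obtain ⟨g, hg, hlim, φ, hφ, hae⟩ := exists_tendsto_of_cauchy_integral
    (fun k => (hz k).2.1.integrable_onEdges) hcau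
  have hc : Tendsto (fun k : ℕ => C.value θ L F G t T p₀ - 1 / ((φ k : ℝ) + 1)) atTop
      (𝓝 (C.value θ L F G t T p₀)) := by
    simpa using (tendsto_const_nhds (x := C.value θ L F G t T p₀)).sub
      (tendsto_one_div_add_atTop_nhds_zero_nat.comp hφ.tendsto_atTop)
  have hlim' : ∀ S ⊆ Icc t T, Tendsto
      (fun k => ∫ s in S, C.onEdges ((z (φ k)).2 s)) atTop (𝓝 (∫ s in S, g s)) := fun S hS => by
    have := (hlim S).comp hφ.tendsto_atTop
    simp only [Measure.restrict_restrict_of_subset hS] at this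
    exact this
  obtain ⟨w, hw, hle⟩ := h.exists_fluxPayoff_ge_of_tendsto (fun k => hz (φ k)) hc
    (fun k => hV (φ k)) hg hlim' hae
  exact ⟨w, hw, le_antisymm (h.isLUB_fluxPayoff.1 (mem_image_of_mem _ hw)) hle⟩

end IsControlProblem

end ReversibleChain

/-! ### Averages over the recent past -/

/-- The uniform probability measure on `(s - ε, s]`. -/
def backwardMeasure (ε s : ℝ) : Measure ℝ :=
  (ENNReal.ofReal ε)⁻¹ • volume.restrict (Ioc (s - ε) s)

theorem isProbabilityMeasure_backwardMeasure {ε : ℝ} (hε : 0 < ε) (s : ℝ) :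
    IsProbabilityMeasure (backwardMeasure ε s) := by
  refine ⟨?_⟩
  simp only [backwardMeasure, Measure.smul_apply, Measure.restrict_apply_univ, Real.volume_Ioc,
    smul_eq_mul, sub_sub_cancel]
  exact ENNReal.inv_mul_cancel (by simpa using hε) ENNReal.ofReal_ne_top

/-- The mean of `f` over the time interval `(s - ε, s]`. -/
def timeAvg (ε : ℝ) (f : ℝ → ℝ) (s : ℝ) : ℝ := ∫ r, f r ∂(backwardMeasure ε s)

theorem timeAvg_eq {ε : ℝ} (hε : 0 < ε) (f : ℝ → ℝ) (s : ℝ) :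
    timeAvg ε f s = ε⁻¹ * ∫ r in (s - ε)..s, f r := by
  rw [timeAvg, backwardMeasure, integral_smul_measure, ENNReal.toReal_inv,
    ENNReal.toReal_ofReal hε.le, intervalIntegral.integral_of_le (by linarith), smul_eq_mul]

theorem integrable_backwardMeasure {ε s : ℝ} (hε : 0 < ε) {f : ℝ → ℝ}
    (hf : IntervalIntegrable f volume (s - ε) s) : Integrable f (backwardMeasure ε s) :=
  ((intervalIntegrable_iff_integrableOn_Ioc_of_le (by linarith)).1 hf).smul_measure
    (by simpa using hε)

theorem timeAvg_eq_zero {ε s : ℝ} {f : ℝ → ℝ} (hf : ∀ r ≤ s, f r = 0) : timeAvg ε f s = 0 := by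
  rw [timeAvg, backwardMeasure, integral_smul_measure,
    setIntegral_eq_zero_of_forall_eq_zero fun r hr => hf r hr.2, smul_zero]

/-- As a difference of primitives, an average has one degree of regularity more than the function
averaged. -/
theorem timeAvg_eq_primitive {ε : ℝ} (hε : 0 < ε) {f : ℝ → ℝ}
    (hf : ∀ a b, IntervalIntegrable f volume a b) (a s : ℝ) :
    timeAvg ε f s = ε⁻¹ * ((∫ r in a..s, f r) - ∫ r in a..(s - ε), f r) := by
  rw [timeAvg_eq hε, intervalIntegral.integral_interval_sub_left (hf _ _) (hf _ _)]

theorem continuous_timeAvg {ε : ℝ} (hε : 0 < ε) {f : ℝ → ℝ}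
    (hf : ∀ a b, IntervalIntegrable f volume a b) : Continuous (timeAvg ε f) := by
  have h := intervalIntegral.continuous_primitive hf 0
  have h2 : Continuous fun s => ∫ r in (0 : ℝ)..(s - ε), f r := h.comp (continuous_sub_right ε)
  exact (continuous_const.mul (h.sub h2)).congr fun s => (timeAvg_eq_primitive hε hf 0 s).symm

theorem hasDerivAt_timeAvg {ε : ℝ} (hε : 0 < ε) {f : ℝ → ℝ} (hf : Continuous f) (s : ℝ) :
    HasDerivAt (timeAvg ε f) (ε⁻¹ * (f s - f (s - ε))) s := by
  have h1 : timeAvg ε f = fun s =>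
      ε⁻¹ * ((∫ r in (0 : ℝ)..s, f r) - ∫ r in (0 : ℝ)..(s - ε), f r) :=
    funext fun s => timeAvg_eq_primitive hε (fun a b => hf.intervalIntegrable a b) 0 s
  rw [h1]
  have h2 := (hf.integral_hasStrictDerivAt 0 (s - ε)).hasDerivAt.comp_sub_const s ε
  exact (((hf.integral_hasStrictDerivAt 0 s).hasDerivAt).sub h2).const_mul _

theorem contDiff_timeAvg {ε : ℝ} (hε : 0 < ε) {f : ℝ → ℝ} (hf : Continuous f) :
    ContDiff ℝ 1 (timeAvg ε f) := by
  refine contDiff_one_iff_deriv.2 ⟨fun s => (hasDerivAt_timeAvg hε hf s).differentiableAt, ?_⟩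
  rw [funext fun s => (hasDerivAt_timeAvg hε hf s).deriv]
  fun_prop

/-- The average is the difference quotient of a primitive with increment `-ε`. -/
theorem tendsto_timeAvg {f : ℝ → ℝ} (hf : Continuous f) (s : ℝ) :
    Tendsto (fun ε => timeAvg ε f s) (𝓝[>] 0) (𝓝 (f s)) := by
  have h := hasDerivAt_iff_tendsto_slope_zero.1
    (hf.integral_hasStrictDerivAt 0 s).hasDerivAt
  have hneg : Tendsto (fun ε : ℝ => -ε) (𝓝[>] 0) (𝓝[≠] 0) := by
    refine tendsto_nhdsWithin_iff.2 ⟨?_, ?_⟩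
    · simpa using (tendsto_id (x := 𝓝 (0 : ℝ))).neg.mono_left nhdsWithin_le_nhds
    · filter_upwards [self_mem_nhdsWithin] with ε hε
      exact neg_ne_zero.2 (ne_of_gt hε)
  refine (h.comp hneg).congr' ?_
  filter_upwards [self_mem_nhdsWithin] with ε hε
  rw [timeAvg_eq_primitive hε (fun a b => hf.intervalIntegrable a b) 0 s]
  simp only [Function.comp, smul_eq_mul, ← sub_eq_add_neg, inv_neg]
  ring

/-- Averaging backwards in time does not increase the integral of a nonnegative function that
vanishes up to the initial time. -/
theorem integral_timeAvg_le {ε t T : ℝ} (hε : 0 < ε) {f : ℝ → ℝ}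
    (hf : ∀ a b, IntervalIntegrable f volume a b) (h0 : ∀ r, 0 ≤ f r) (ht : ∀ r ≤ t, f r = 0) :
    ∫ s in t..T, timeAvg ε f s ≤ ∫ s in t..T, f s := by
  set P : ℝ → ℝ := fun s => ∫ r in t..s, f r
  have hP : Continuous P := intervalIntegral.continuous_primitive hf t
  have hPi : ∀ a b, IntervalIntegrable P volume a b := fun a b => hP.intervalIntegrable a b
  have hmono : Monotone P := fun a b hab => by
    have := intervalIntegral.integral_nonneg (μ := volume) hab fun r _ => h0 r
    rw [← intervalIntegral.integral_interval_sub_left (hf t b) (hf t a)] at this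
    simp only [P]
    linarith
  have hP0 : ∀ s ≤ t, P s = 0 := fun s hs => by
    refine intervalIntegral.integral_zero_ae (ae_of_all _ fun r hr => ht r ?_)
    rw [uIoc_of_ge hs] at hr
    exact hr.2
  have h1 : ∫ s in t..T, timeAvg ε f s = ε⁻¹ * ((∫ s in t..T, P s) - ∫ s in t..T, P (s - ε)) := by
    have hP' : IntervalIntegrable (fun s => P (s - ε)) volume t T :=
      (hP.comp (continuous_sub_right ε)).intervalIntegrable _ _
    simp only [timeAvg_eq_primitive hε hf t]
    rw [intervalIntegral.integral_const_mul, ← intervalIntegral.integral_sub (hPi t T) hP']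
  have h2 : ∫ s in (t - ε)..t, P s = 0 := by
    refine intervalIntegral.integral_zero_ae (ae_of_all _ fun r hr => hP0 r ?_)
    rw [uIoc_of_le (by linarith)] at hr
    exact hr.2
  -- After a shift of variables only the last interval of length `ε` remains, since `P` vanishes
  -- before `t`; there the monotone `P` is at most `P T`.
  have h3 : ∫ s in (T - ε)..T, P s ≤ ε * P T := by
    have := intervalIntegral.integral_mono_on (μ := volume) (show T - ε ≤ T by linarith)
      (hPi _ _) intervalIntegrable_const (g := fun _ => P T) fun r hr => hmono hr.2
    simpa using this
  have h4 : (∫ s in t..T, P s) - ∫ s in t..T, P (s - ε) = ∫ s in (T - ε)..T, P s := by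
    rw [intervalIntegral.integral_comp_sub_right P ε]
    have a1 := intervalIntegral.integral_add_adjacent_intervals (hPi (t - ε) t) (hPi t T)
    have a2 := intervalIntegral.integral_add_adjacent_intervals (hPi (t - ε) (T - ε))
      (hPi (T - ε) T)
    linarith
  rw [h1, h4]
  calc ε⁻¹ * ∫ s in (T - ε)..T, P s ≤ ε⁻¹ * (ε * P T) :=
        mul_le_mul_of_nonneg_left h3 (by positivity)
    _ = P T := by field_simp

/-! ### Regularization of feasible pairs -/

namespace ReversibleChain

variable {n : ℕ} {C : ReversibleChain n} {θ : ℝ → ℝ → ℝ} {L : Fin n → Fin n → ℝ → ℝ}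
  {F G : (Fin n → ℝ) → ℝ} {t T : ℝ} {p₀ : Fin n → ℝ}

/-- A density-flux pair on the whole time axis which rests at `p₀` up to time `t`. -/
structure IsGlobalFlux (C : ReversibleChain n) (θ : ℝ → ℝ → ℝ) (L : Fin n → Fin n → ℝ → ℝ)
    (t : ℝ) (p₀ : Fin n → ℝ) (w : PathPair n) : Prop where
  mem_simplex : ∀ s, w.1 s ∈ stdSimplex ℝ (Fin n)
  density_before : ∀ s ≤ t, w.1 s = p₀
  flux_before : ∀ s ≤ t, ∀ i j, w.2 s i j = 0
  antisymm : ∀ s i j, (i, j) ∈ C.edges → w.2 s i j = -w.2 s j i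
  flux_eq_zero : ∀ e ∈ C.edges, ∀ s, C.act θ (w.1 s) e.1 e.2 = 0 → w.2 s e.1 e.2 = 0
  integrable : ∀ i j a b, IntervalIntegrable (fun s => w.2 s i j) volume a b
  integrable_cost : ∀ e ∈ C.edges, ∀ a b, IntervalIntegrable (C.cost θ L w e) volume a b
  sub_eq : ∀ a b i, w.1 b i - w.1 a i = -∫ r in a..b, C.divergence (w.2 r) i

/-- The time averages of a density-flux pair. -/
def pathAvg (ε : ℝ) (w : PathPair n) : PathPair n :=
  (fun s i => timeAvg ε (fun r => w.1 r i) s, fun s i j => timeAvg ε (fun r => w.2 r i j) s)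

namespace IsGlobalFlux

variable {w : PathPair n}

theorem integrable_divergence (hw : C.IsGlobalFlux θ L t p₀ w) (i : Fin n) (a b : ℝ) :
    IntervalIntegrable (fun s => C.divergence (w.2 s) i) volume a b := by
  simp only [divergence]
  have := IntervalIntegrable.sum (μ := volume) (a := a) (b := b) (C.nbhd i)
    (f := fun j s => √(C.weight i j) * w.2 s i j) fun j _ => (hw.integrable i j a b).const_mul _
  refine this.congr fun s _ => ?_
  simp

theorem continuous (hw : C.IsGlobalFlux θ L t p₀ w) : Continuous w.1 := by
  refine continuous_pi fun i => ?_
  have h := intervalIntegral.continuous_primitive (hw.integrable_divergence i) t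
  refine ((continuous_const (y := w.1 t i)).sub h).congr fun s => ?_
  have := hw.sub_eq t s i
  change w.1 t i - ∫ r in t..s, C.divergence (w.2 r) i = w.1 s i
  linarith

theorem continuous_apply (hw : C.IsGlobalFlux θ L t p₀ w) (i : Fin n) :
    Continuous fun s => w.1 s i := (continuous_pi_iff.1 hw.continuous) i

theorem continuous_comp (hw : C.IsGlobalFlux θ L t p₀ w) {f : (Fin n → ℝ) → ℝ}
    (hf : ContinuousOn f (stdSimplex ℝ (Fin n))) : Continuous fun s => f (w.1 s) :=
  hf.comp_continuous hw.continuous hw.mem_simplex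

theorem mem_fluxes (hw : C.IsGlobalFlux θ L t p₀ w) : w ∈ C.fluxes θ L t T p₀ := by
  refine ReversibleChain.mem_fluxes.2 ⟨fun s _ i j he => hw.antisymm s i j he,
    ⟨fun s _ => hw.mem_simplex s, fun i j _ => ?_, fun s _ i => ?_⟩,
    fun e he => ⟨fun s _ => hw.flux_eq_zero e he s, ?_⟩⟩
  · rcases le_or_gt t T with h | h
    · exact (intervalIntegrable_iff_integrableOn_Icc_of_le h).1 (hw.integrable i j t T)
    · simp [Icc_eq_empty_of_lt h]
  · have := hw.sub_eq t s i
    rw [hw.density_before t le_rfl] at this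
    linarith
  · rcases le_or_gt t T with h | h
    · exact (intervalIntegrable_iff_integrableOn_Icc_of_le h).1 (hw.integrable_cost e he t T)
    · simp [Icc_eq_empty_of_lt h]

end IsGlobalFlux

namespace IsControlProblem

/-- Every feasible pair extends to the whole time axis with the same payoff. -/
theorem exists_isGlobalFlux (h : C.IsControlProblem θ L F G t T p₀) {z : PathPair n}
    (hz : z ∈ C.fluxes θ L t T p₀) : ∃ w, C.IsGlobalFlux θ L t p₀ w ∧
      C.fluxPayoff θ L F G t T w = C.fluxPayoff θ L F G t T z := by
  classical
  -- The density is frozen outside `[t, T]`. The flux is zero there, at time `t` and off the edges;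
  -- the last makes all components integrable, as smoothness of the whole field will require.
  let q : ℝ → Fin n → ℝ := fun s => z.1 (projIcc t T h.le s)
  let m : ℝ → Fin n → Fin n → ℝ := fun s i j =>
    if s ∈ Ioc t T ∧ (i, j) ∈ C.edges then z.2 s i j else 0
  have hsub : Ioc t T ⊆ Icc t T := Ioc_subset_Icc_self
  have hm : ∀ s ∈ Ioc t T, ∀ i j, (i, j) ∈ C.edges → m s i j = z.2 s i j :=
    fun s hs i j he => if_pos ⟨hs, he⟩
  have hm0 : ∀ s, s ∉ Ioc t T → m s = 0 := fun s hs => by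
    ext i j
    exact if_neg fun hh => hs hh.1
  have hq : ∀ s ∈ Icc t T, q s = z.1 s := fun s hs => by
    simp only [q, projIcc_of_mem h.le hs]
  have hqs : ∀ s, q s ∈ stdSimplex ℝ (Fin n) := fun s => hz.2.1.mem_simplex _ (projIcc t T h.le s).2
  have ht : t ∈ Icc t T := left_mem_Icc.2 h.le
  have hT : T ∈ Icc t T := right_mem_Icc.2 h.le
  have hint : ∀ i j, Integrable fun s => m s i j := fun i j => by
    by_cases he : (i, j) ∈ C.edges
    · refine ((integrable_indicator_iff measurableSet_Ioc).2
        ((hz.2.1.integrable i j he).mono_set hsub)).congr (ae_of_all _ fun s => ?_)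
      change _ = m s i j
      by_cases hs : s ∈ Ioc t T
      · rw [indicator_of_mem hs, hm s hs i j he]
      · rw [indicator_of_notMem hs, hm0 s hs]
        rfl
    · simp [m, he]
  have hcost : ∀ e ∈ C.edges, C.cost θ L (q, m) e = (Ioc t T).indicator (C.cost θ L z e) := by
    intro e he
    ext s
    by_cases hs : s ∈ Ioc t T
    · rw [indicator_of_mem hs]
      simp only [cost, hm s hs e.1 e.2 he, hq s (hsub hs)]
    · rw [indicator_of_notMem hs]
      simp only [cost, hm0 s hs, Pi.zero_apply, (h.isCost he).persp_zero_right]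
  have hdiv : ∀ i, Integrable fun s => C.divergence (m s) i := fun i =>
    integrable_finsetSum _ fun j _ => (hint i j).const_mul _
  have hq_eq : ∀ s i, q s i = p₀ i - ∫ r in t..s, C.divergence (m r) i := by
    intro s i
    have hin : ∀ s ∈ Icc t T, z.1 s i = p₀ i - ∫ r in t..s, C.divergence (m r) i := by
      intro s hs
      rw [hz.2.1.eqn s hs i]
      congr 1
      refine intervalIntegral.integral_congr_ae (ae_of_all _ fun r hr => ?_)
      rw [uIoc_of_le hs.1] at hr
      exact (divergence_congr (hm r ⟨hr.1, hr.2.trans hs.2⟩) i).symm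
    rcases le_total s t with hs | hs
    · have e1 : q s = z.1 t := by simp only [q, projIcc_of_le_left h.le hs]
      rw [e1, hz.2.1.apply_left h.le, intervalIntegral.integral_zero_ae, sub_zero]
      refine ae_of_all _ fun r hr => ?_
      rw [uIoc_of_ge hs] at hr
      rw [hm0 r fun h => h.1.not_ge hr.2, divergence_zero]
    rcases le_total s T with hs' | hs'
    · rw [hq s ⟨hs, hs'⟩, hin s ⟨hs, hs'⟩]
    · have e1 : q s = z.1 T := by simp only [q, projIcc_of_right_le h.le hs']
      have e2 : ∫ r in T..s, C.divergence (m r) i = 0 := by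
        refine intervalIntegral.integral_zero_ae (ae_of_all _ fun r hr => ?_)
        rw [uIoc_of_le hs'] at hr
        rw [hm0 r fun h => hr.1.not_ge h.2, divergence_zero]
      rw [e1, hin T hT, ← intervalIntegral.integral_add_adjacent_intervals
        ((hdiv i).intervalIntegrable (a := t) (b := T))
        ((hdiv i).intervalIntegrable (a := T) (b := s)), e2, add_zero]
  have hw : C.IsGlobalFlux θ L t p₀ (q, m) := by
    refine ⟨hqs, fun s hs => ?_, fun s hs i j => ?_, fun s i j he => ?_, fun e he s h0 => ?_,
      fun i j a b => (hint i j).intervalIntegrable, fun e he a b => ?_, fun a b i => ?_⟩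
    · simp only [q, projIcc_of_le_left h.le hs, hz.2.1.apply_left h.le]
    · change m s i j = 0
      rw [hm0 s fun h => h.1.not_ge hs]
      rfl
    · change m s i j = -m s j i
      by_cases hs : s ∈ Ioc t T
      · rw [hm s hs i j he, hm s hs j i (swap_mem_edges he), hz.1 s (hsub hs) i j he]
      · simp [hm0 s hs]
    · change m s e.1 e.2 = 0
      by_cases hs : s ∈ Ioc t T
      · rw [hm s hs e.1 e.2 he]
        refine (hz.2.2 e.1 e.2 he).1 s (hsub hs) ?_
        rw [← hq s (hsub hs)]
        exact h0
      · simp [hm0 s hs]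
    · rw [hcost e he]
      exact ((integrable_indicator_iff measurableSet_Ioc).2
        (((ReversibleChain.mem_fluxes.1 hz).2.2 e he).2.mono_set hsub)).intervalIntegrable
    · have i1 := (hdiv i).intervalIntegrable (a := t) (b := a)
      have i2 := (hdiv i).intervalIntegrable (a := t) (b := b)
      change q b i - q a i = _
      rw [hq_eq b i, hq_eq a i, ← intervalIntegral.integral_interval_sub_left i2 i1]
      ring
  refine ⟨_, hw, ?_⟩
  rw [h.fluxPayoff_eq hw.mem_fluxes, h.fluxPayoff_eq hz]
  congr 1
  · congr 1
    · exact congrArg G (hq T hT)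
    · congr 1
      refine Finset.sum_congr rfl fun e he => ?_
      rw [edgeCost, edgeCost, hcost e he, integral_Icc_eq_integral_Ioc,
        integral_Icc_eq_integral_Ioc, setIntegral_indicator measurableSet_Ioc, inter_self]
  · exact setIntegral_congr_fun measurableSet_Icc fun s hs => congrArg F (hq s hs)

variable {w : PathPair n} {ε : ℝ}

/-- The average is a mean over a probability measure: it stays in the closed convex simplex, and
Jensen's inequality applies to the concave activation. -/
theorem pathAvg_mem_simplex (h : C.IsControlProblem θ L F G t T p₀)
    (hw : C.IsGlobalFlux θ L t p₀ w) (hε : 0 < ε) (s : ℝ) (e : Fin n × Fin n) :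
    (pathAvg ε w).1 s ∈ stdSimplex ℝ (Fin n) ∧
      timeAvg ε (fun r => C.act θ (w.1 r) e.1 e.2) s ≤ C.act θ ((pathAvg ε w).1 s) e.1 e.2 := by
  have := isProbabilityMeasure_backwardMeasure hε s
  have hi : ∀ {f : ℝ → ℝ}, Continuous f → Integrable f (backwardMeasure ε s) := fun hf =>
    integrable_backwardMeasure hε (hf.intervalIntegrable _ _)
  have hwi : Integrable w.1 (backwardMeasure ε s) :=
    Integrable.of_eval fun i => hi (hw.continuous_apply i)
  have he : (pathAvg ε w).1 s = ∫ r, w.1 r ∂(backwardMeasure ε s) := by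
    ext i
    rw [eval_integral fun i => hwi.eval i]
    rfl
  rw [he]
  exact ⟨(convex_stdSimplex ℝ (Fin n)).integral_mem (isClosed_stdSimplex ℝ (Fin n))
    (ae_of_all _ hw.mem_simplex) hwi,
    (C.concaveOn_act h.concaveOn e.1 e.2).le_map_integral
      (C.continuousOn_act h.isActivation e.1 e.2) (isClosed_stdSimplex ℝ (Fin n))
      (ae_of_all _ hw.mem_simplex) hwi
      (hi (hw.continuous_comp (C.continuousOn_act h.isActivation e.1 e.2)))⟩

/-- This is Jensen's inequality for the perspective; concavity of the activation supplies the
inequality it needs. -/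
theorem cost_pathAvg_le (h : C.IsControlProblem θ L F G t T p₀)
    (hw : C.IsGlobalFlux θ L t p₀ w) (hε : 0 < ε) {e : Fin n × Fin n} (he : e ∈ C.edges) (s : ℝ) :
    C.cost θ L (pathAvg ε w) e s ≤ timeAvg ε (C.cost θ L w e) s :=
  (h.isCost he).persp_integral_le
    (integrable_backwardMeasure hε ((hw.continuous_comp
      (C.continuousOn_act h.isActivation e.1 e.2)).intervalIntegrable _ _))
    (integrable_backwardMeasure hε (hw.integrable e.1 e.2 _ _))
    (integrable_backwardMeasure hε (hw.integrable_cost e he _ _))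
    (fun r => act_nonneg h.isActivation (hw.mem_simplex r) _ _) (hw.flux_eq_zero e he)
    (h.pathAvg_mem_simplex hw hε s e).2

/-- Averaging respects the linear equation and the convex constraints, and looking only at the past
preserves the rest before `t`. -/
theorem isGlobalFlux_pathAvg (h : C.IsControlProblem θ L F G t T p₀)
    (hw : C.IsGlobalFlux θ L t p₀ w) (hε : 0 < ε) :
    C.IsGlobalFlux θ L t p₀ (pathAvg ε w) := by
  have hsimp : ∀ s, (pathAvg ε w).1 s ∈ stdSimplex ℝ (Fin n) := fun s => by
    rcases isEmpty_or_nonempty (Fin n) with hn | ⟨⟨i⟩⟩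
    · exact (Subsingleton.elim p₀ ((pathAvg ε w).1 s)) ▸ h.mem_simplex
    · exact (h.pathAvg_mem_simplex hw hε s (i, i)).1
  have hmc : ∀ i j, Continuous fun s => (pathAvg ε w).2 s i j := fun i j =>
    continuous_timeAvg hε (hw.integrable i j)
  have hpc : Continuous (pathAvg ε w).1 := continuous_pi fun i =>
    continuous_timeAvg hε fun a b => (hw.continuous_apply i).intervalIntegrable a b
  refine ⟨hsimp, fun s hs => ?_, fun s hs i j => ?_, fun s i j he => ?_, fun e he s h0 => ?_,
    fun i j a b => (hmc i j).intervalIntegrable a b, fun e he a b => ?_, fun a b i => ?_⟩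
  · ext i
    have h1 : ∫ r in (s - ε)..s, w.1 r i = ∫ r in (s - ε)..s, p₀ i := by
      refine intervalIntegral.integral_congr fun r hr => ?_
      rw [uIcc_of_le (by linarith)] at hr
      exact congrFun (hw.density_before r (hr.2.trans hs)) i
    simp only [pathAvg]
    rw [timeAvg_eq hε, h1, intervalIntegral.integral_const, sub_sub_cancel, smul_eq_mul]
    field_simp
  · exact timeAvg_eq_zero fun r hr => hw.flux_before r (hr.trans hs) i j
  · simp only [pathAvg, timeAvg, hw.antisymm _ i j he, integral_neg]
  · have hact := hw.continuous_comp (C.continuousOn_act h.isActivation e.1 e.2)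
    have hnn : ∀ r, 0 ≤ C.act θ (w.1 r) e.1 e.2 := fun r =>
      act_nonneg h.isActivation (hw.mem_simplex r) _ _
    -- If the activation of the average vanishes, so does the smaller average of the activations.
    -- The activation, and with it the flux, is then zero almost everywhere in the window.
    have h1 := (h.pathAvg_mem_simplex hw hε s e).2
    rw [h0] at h1
    have h2 : timeAvg ε (fun r => C.act θ (w.1 r) e.1 e.2) s = 0 :=
      le_antisymm h1 (integral_nonneg hnn)
    have h3 := (integral_eq_zero_iff_of_nonneg hnn
      (integrable_backwardMeasure hε (hact.intervalIntegrable _ _))).1 h2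
    exact integral_eq_zero_of_ae (h3.mono fun r hr => hw.flux_eq_zero e he r hr)
  · have hact : Continuous fun s => C.act θ ((pathAvg ε w).1 s) e.1 e.2 :=
      (C.continuousOn_act h.isActivation e.1 e.2).comp_continuous hpc hsimp
    have hmeas : Measurable (C.cost θ L (pathAvg ε w) e) :=
      hact.measurable.mul ((h.isCost he).continuous.measurable.comp
        ((hmc e.1 e.2).measurable.div hact.measurable))
    refine ((continuous_timeAvg hε (hw.integrable_cost e he)).intervalIntegrable a b).mono_fun'
      hmeas.aestronglyMeasurable (ae_of_all _ fun s => ?_)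
    beta_reduce
    rw [Real.norm_of_nonneg (h.cost_nonneg (hsimp s) he)]
    exact h.cost_pathAvg_le hw hε he s
  · have hd : ∀ s, HasDerivAt (fun s => (pathAvg ε w).1 s i)
        (-C.divergence ((pathAvg ε w).2 s) i) s := by
      intro s
      -- The derivative is the increment of the density over the window divided by `ε`, which the
      -- continuity equation turns into minus the averaged divergence.
      refine (hasDerivAt_timeAvg hε (hw.continuous_apply i) s).congr_deriv ?_
      rw [hw.sub_eq]
      simp only [divergence, pathAvg]
      rw [intervalIntegral.integral_finsetSum fun j _ => (hw.integrable i j _ _).const_mul _,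
        mul_neg, Finset.mul_sum]
      congr 1
      refine Finset.sum_congr rfl fun j _ => ?_
      rw [timeAvg_eq hε, intervalIntegral.integral_const_mul]
      ring
    have hc : Continuous fun s => -C.divergence ((pathAvg ε w).2 s) i := by
      simp only [divergence]
      exact (continuous_finsetSum _ fun j _ => (hmc i j).const_mul _).neg
    rw [← intervalIntegral.integral_neg]
    exact (intervalIntegral.integral_eq_sub_of_hasDerivAt (fun s _ => hd s)
      (hc.intervalIntegrable a b)).symm

theorem edgeCost_pathAvg_le (h : C.IsControlProblem θ L F G t T p₀)
    (hw : C.IsGlobalFlux θ L t p₀ w) (hε : 0 < ε) {e : Fin n × Fin n} (he : e ∈ C.edges) :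
    C.edgeCost θ L t T (pathAvg ε w) e ≤ C.edgeCost θ L t T w e := by
  rw [edgeCost, edgeCost, integral_Icc_eq_integral_Ioc, integral_Icc_eq_integral_Ioc,
    ← intervalIntegral.integral_of_le h.le, ← intervalIntegral.integral_of_le h.le]
  refine (intervalIntegral.integral_mono_on h.le
    ((h.isGlobalFlux_pathAvg hw hε).integrable_cost e he t T)
    ((continuous_timeAvg hε (hw.integrable_cost e he)).intervalIntegrable t T)
    fun s _ => h.cost_pathAvg_le hw hε he s).trans
    (integral_timeAvg_le hε (hw.integrable_cost e he)
      (fun r => h.cost_nonneg (hw.mem_simplex r) he) fun r hr => ?_)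
  simp only [cost, hw.flux_before r hr, (h.isCost he).persp_zero_right]

/-- The cost does not grow for any `ε`, so only the continuous terms `F` and `G` matter, and these
converge as `ε` tends to zero. -/
theorem exists_pathAvg_payoff_ge (h : C.IsControlProblem θ L F G t T p₀)
    (hw : C.IsGlobalFlux θ L t p₀ w) {δ : ℝ} (hδ : 0 < δ) :
    ∃ ε, 0 < ε ∧ C.fluxPayoff θ L F G t T w - δ ≤ C.fluxPayoff θ L F G t T (pathAvg ε w) := by
  have hglob : ∀ ε, 0 < ε → C.IsGlobalFlux θ L t p₀ (pathAvg ε w) := fun ε hε =>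
    h.isGlobalFlux_pathAvg hw hε
  have hcomp : ∀ f : (Fin n → ℝ) → ℝ, ContinuousOn f (stdSimplex ℝ (Fin n)) → ∀ s,
      Tendsto (fun ε => f ((pathAvg ε w).1 s)) (𝓝[>] 0) (𝓝 (f (w.1 s))) := by
    intro f hf s
    refine (hf _ (hw.mem_simplex s)).tendsto.comp (tendsto_nhdsWithin_iff.2
      ⟨tendsto_pi_nhds.2 fun i => tendsto_timeAvg (hw.continuous_apply i) s, ?_⟩)
    filter_upwards [self_mem_nhdsWithin] with ε hε
    exact (hglob ε hε).mem_simplex s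
  have hF : Tendsto (fun ε => ∫ s in Icc t T, F ((pathAvg ε w).1 s)) (𝓝[>] 0)
      (𝓝 (∫ s in Icc t T, F (w.1 s))) := by
    obtain ⟨b, hb⟩ := (isCompact_stdSimplex ℝ (Fin n)).exists_bound_of_continuousOn
      h.continuousOn_running
    refine tendsto_integral_filter_of_dominated_convergence (fun _ => b) ?_ ?_
      (integrableOn_const (by simp)) (ae_of_all _ fun s => hcomp F h.continuousOn_running s)
    · filter_upwards [self_mem_nhdsWithin] with ε hε
      exact ((hglob ε hε).continuous_comp h.continuousOn_running).aestronglyMeasurable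
    · filter_upwards [self_mem_nhdsWithin] with ε hε
      exact ae_of_all _ fun s => hb _ ((hglob ε hε).mem_simplex s)
  have hlim := (hcomp G h.continuousOn_final T).add hF
  have hev := hlim.eventually_const_lt
    (show G (w.1 T) + (∫ s in Icc t T, F (w.1 s)) - δ <
      G (w.1 T) + ∫ s in Icc t T, F (w.1 s) by linarith)
  obtain ⟨ε, h1, hε⟩ := (hev.and self_mem_nhdsWithin).exists
  refine ⟨ε, hε, ?_⟩
  rw [h.fluxPayoff_eq hw.mem_fluxes, h.fluxPayoff_eq (hglob ε hε).mem_fluxes]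
  have := Finset.sum_le_sum fun e he => h.edgeCost_pathAvg_le hw hε (e := e) he
  linarith

theorem exists_isC1Pair_payoff_ge (h : C.IsControlProblem θ L F G t T p₀) {z : PathPair n}
    (hz : z ∈ C.fluxes θ L t T p₀) {δ : ℝ} (hδ : 0 < δ) :
    ∃ w ∈ C.fluxes θ L t T p₀, IsC1Pair t T w ∧
      C.fluxPayoff θ L F G t T z - δ ≤ C.fluxPayoff θ L F G t T w := by
  obtain ⟨w, hw, hwz⟩ := h.exists_isGlobalFlux hz
  obtain ⟨ε, hε, h1⟩ := h.exists_pathAvg_payoff_ge hw (half_pos hδ)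
  have hw₁ := h.isGlobalFlux_pathAvg hw hε
  -- Two averages are needed for the flux: the first makes it continuous, the second `C¹`.
  obtain ⟨ε', hε', h2⟩ := h.exists_pathAvg_payoff_ge hw₁ (half_pos hδ)
  refine ⟨_, (h.isGlobalFlux_pathAvg hw₁ hε').mem_fluxes, ⟨?_, ?_⟩, by linarith⟩
  · exact (contDiff_pi.2 fun i =>
      contDiff_timeAvg hε' (hw₁.continuous_apply i)).contDiffOn
  · exact (contDiff_pi.2 fun i => contDiff_pi.2 fun j =>
      contDiff_timeAvg hε' (continuous_timeAvg hε (hw.integrable i j))).contDiffOn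

theorem isLUB_fluxPayoff_isC1Pair (h : C.IsControlProblem θ L F G t T p₀) :
    IsLUB (C.fluxPayoff θ L F G t T '' {z ∈ C.fluxes θ L t T p₀ | IsC1Pair t T z})
      (C.value θ L F G t T p₀) := by
  refine ⟨fun x hx => ?_, fun b hb => le_of_forall_pos_sub_le fun δ hδ => ?_⟩
  · obtain ⟨z, hz, rfl⟩ := hx
    exact h.isLUB_fluxPayoff.1 (mem_image_of_mem _ hz.1)
  · obtain ⟨z, hz, hzV⟩ := h.isGreatest_fluxPayoff.1
    obtain ⟨w, hw, hw1, hle⟩ := h.exists_isC1Pair_payoff_ge hz hδ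
    rw [← hzV]
    exact hle.trans (hb (mem_image_of_mem _ ⟨hw, hw1⟩))

theorem contDiffOn_act (h : C.IsControlProblem θ L F G t T p₀) {p : ℝ → Fin n → ℝ} {S : Set ℝ}
    (hp : ContDiffOn ℝ 1 p S) (hpos : ∀ s ∈ S, ∀ i, 0 < p s i) (i j : Fin n) :
    ContDiffOn ℝ 1 (fun s => C.act θ (p s) i j) S := by
  refine h.isActivation.contDiffOn.comp
    (f := fun s => (p s i / C.stat i, p s j / C.stat j)) ?_ fun s hs =>
      ⟨div_pos (hpos s hs i) (C.stat_pos i), div_pos (hpos s hs j) (C.stat_pos j)⟩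
  exact ((contDiffOn_pi.1 hp i).div_const _).prodMk ((contDiffOn_pi.1 hp j).div_const _)

/-- Mixing a smooth pair with rest at the positive `p₀` makes the density positive up to `T`, where
the activation is `C¹` and nonzero, so the velocity is smooth. Concavity bounds the loss of payoff.
-/
theorem isLUB_controlPayoff_isC1Pair (h : C.IsControlProblem θ L F G t T p₀)
    (hpos : ∀ i, 0 < p₀ i) :
    IsLUB (C.controlPayoff θ L F G t T '' {z ∈ C.controls θ L t T p₀ | IsC1Pair t T z})
      (C.value θ L F G t T p₀) := by
  refine ⟨fun x hx => ?_, fun b hb => le_of_forall_pos_sub_le fun δ hδ => ?_⟩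
  · obtain ⟨z, hz, rfl⟩ := hx
    refine h.isLUB_fluxPayoff.1 ?_
    rw [← h.image_controlPayoff]
    exact mem_image_of_mem _ hz.1
  obtain ⟨z, hz, hzV⟩ := h.isGreatest_fluxPayoff.1
  obtain ⟨w, hw, hw1, hle⟩ := h.exists_isC1Pair_payoff_ge hz (half_pos hδ)
  rw [hzV] at hle
  let c : PathPair n := (fun _ => p₀, 0)
  have hc : c ∈ C.fluxes θ L t T p₀ := h.const_mem_fluxes
  set D := |C.fluxPayoff θ L F G t T w - C.fluxPayoff θ L F G t T c|
  have hD : 0 ≤ D := abs_nonneg _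
  -- This weight lies in `(0, 1]` and costs at most `a * D ≤ δ / 2`.
  set a : ℝ := (δ / 2) / (δ / 2 + D)
  have ha0 : 0 < a := by positivity
  have ha1 : a ≤ 1 := (div_le_one (by positivity)).2 (by linarith)
  have haD : a * D ≤ δ / 2 := by
    rw [div_mul_eq_mul_div, div_le_iff₀ (by positivity)]
    nlinarith
  have hmix : (1 - a) • w + a • c ∈ C.fluxes θ L t T p₀ :=
    h.convex_fluxes hw hc (by linarith) ha0.le (by ring)
  have hpay := h.concaveOn_fluxPayoff.2 hw hc (sub_nonneg.2 ha1) ha0.le (by ring)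
  set q : ℝ → Fin n → ℝ := ((1 - a) • w + a • c).1
  set m : ℝ → Fin n → Fin n → ℝ := ((1 - a) • w + a • c).2
  have hqpos : ∀ s ∈ Icc t T, ∀ i, 0 < q s i := fun s hs i => by
    change 0 < (1 - a) * w.1 s i + a * p₀ i
    have := mul_nonneg (sub_nonneg.2 ha1) ((hw.2.1.mem_simplex s hs).1 i)
    have := mul_pos ha0 (hpos i)
    linarith
  have hq1 : ContDiffOn ℝ 1 q (Icc t T) :=
    (hw1.1.const_smul (1 - a)).add (contDiffOn_const (c := a • p₀))
  have hm1 : ContDiffOn ℝ 1 m (Icc t T) :=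
    (hw1.2.const_smul (1 - a)).add (contDiffOn_const (c := (a • 0 : Fin n → Fin n → ℝ)))
  obtain ⟨hv, -, hvp⟩ := h.exists_control (p := q) (m := m) hmix
  have hC1 : IsC1Pair t T (q, fun s i j => m s i j / C.act θ (q s) i j) := by
    refine ⟨hq1, contDiffOn_pi.2 fun i => contDiffOn_pi.2 fun j => ?_⟩
    exact (contDiffOn_pi.1 (contDiffOn_pi.1 hm1 i) j).div (h.contDiffOn_act hq1 hqpos i j)
      fun s hs => (act_pos h.isActivation (hqpos s hs) i j).ne'
  have h1 := hb (mem_image_of_mem _ ⟨hv, hC1⟩)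
  rw [hvp] at h1
  have h2 : a * (C.fluxPayoff θ L F G t T w - C.fluxPayoff θ L F G t T c) ≤ a * D :=
    mul_le_mul_of_nonneg_left (le_abs_self _) ha0.le
  have h3 : C.fluxPayoff θ L F G t T ((1 - a) • w + a • c) ≤ b := h1
  simp only [smul_eq_mul] at hpay
  linarith

end IsControlProblem

/-! ### Uniqueness at positive densities -/

/-- Near a positive density the activation is Lipschitz relative to its size. -/
theorem exists_act_sub_le (C : ReversibleChain n) (hθ : IsActivation θ) {p : Fin n → ℝ}
    (hp : ∀ i, 0 < p i) (i j : Fin n) :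
    ∃ κ, 0 ≤ κ ∧ ∃ U ∈ 𝓝 p, ∀ q ∈ U, ∀ q' ∈ U, 0 < C.act θ q i j ∧
      |C.act θ q' i j - C.act θ q i j| ≤ κ * ‖q' - q‖ * C.act θ q i j := by
  have hd : ContDiffAt ℝ 1 (fun q => C.act θ q i j) p := by
    have h1 : ContDiffAt ℝ 1 (fun z : ℝ × ℝ => θ z.1 z.2) (p i / C.stat i, p j / C.stat j) :=
      hθ.contDiffOn.contDiffAt ((isOpen_Ioi.prod isOpen_Ioi).mem_nhds
        ⟨div_pos (hp i) (C.stat_pos i), div_pos (hp j) (C.stat_pos j)⟩)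
    exact h1.comp (f := fun q : Fin n → ℝ => (q i / C.stat i, q j / C.stat j)) p
      (((contDiff_apply ℝ ℝ i).div_const _).prodMk
        ((contDiff_apply ℝ ℝ j).div_const _)).contDiffAt
  obtain ⟨K, U, hU, hK⟩ := hd.exists_lipschitzOnWith
  have hpos := act_pos (C := C) hθ hp i j
  set c := C.act θ p i j
  have hev : ∀ᶠ q in 𝓝 p, c / 2 < C.act θ q i j :=
    hd.continuousAt.eventually_const_lt (half_lt_self hpos)
  -- The activation exceeds `c / 2` nearby, which turns the Lipschitz constant `K` into a relative
  -- one.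
  refine ⟨K / (c / 2), by positivity, _, inter_mem hU hev, fun q hq q' hq' => ?_⟩
  have h1 := hK.norm_sub_le hq'.1 hq.1
  have h2 : c / 2 < C.act θ q i j := hq.2
  refine ⟨(half_pos hpos).trans h2, ?_⟩
  rw [Real.norm_eq_abs] at h1
  refine h1.trans ?_
  have h3 : (K : ℝ) * ‖q' - q‖ = K / (c / 2) * ‖q' - q‖ * (c / 2) := by field_simp
  rw [h3]
  exact mul_le_mul_of_nonneg_left h2.le (by positivity)

theorem divergence_sub (m m' : Fin n → Fin n → ℝ) (i : Fin n) :
    C.divergence m i - C.divergence m' i =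
      ∑ j ∈ C.nbhd i, √(C.weight i j) * (m i j - m' i j) := by
  simp only [divergence, ← Finset.sum_sub_distrib, mul_sub]

namespace IsControlProblem

variable {z w : PathPair n}

/-- At the midpoint of two maximizers the running cost is the mean of the two running costs. -/
theorem cost_midpoint_eq (h : C.IsControlProblem θ L F G t T p₀)
    (hz : z ∈ C.fluxes θ L t T p₀) (hw : w ∈ C.fluxes θ L t T p₀)
    (hzm : IsMaxOn (C.fluxPayoff θ L F G t T) (C.fluxes θ L t T p₀) z)
    (hwm : IsMaxOn (C.fluxPayoff θ L F G t T) (C.fluxes θ L t T p₀) w)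
    {e : Fin n × Fin n} (he : e ∈ C.edges) :
    ∀ᵐ s ∂(volume.restrict (Icc t T)), C.cost θ L ((1 / 2 : ℝ) • z + (1 / 2 : ℝ) • w) e s =
      1 / 2 * C.cost θ L z e s + 1 / 2 * C.cost θ L w e s := by
  have ha : (0 : ℝ) ≤ 1 / 2 := by norm_num
  have hab : (1 / 2 : ℝ) + 1 / 2 = 1 := by norm_num
  set u := (1 / 2 : ℝ) • z + (1 / 2 : ℝ) • w
  have hu : u ∈ C.fluxes θ L t T p₀ := h.convex_fluxes hz hw ha ha hab
  have h1 : C.fluxPayoff θ L F G t T u ≤ C.fluxPayoff θ L F G t T z := hzm hu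
  have h2 : C.fluxPayoff θ L F G t T u ≤ C.fluxPayoff θ L F G t T w := hwm hu
  rw [h.fluxPayoff_eq hu, h.fluxPayoff_eq hz] at h1
  rw [h.fluxPayoff_eq hu, h.fluxPayoff_eq hw] at h2
  have h3 := h.le_integral_running hz hw ha ha hab
  have h4 := h.le_final hz hw ha ha hab
  have hgap : ∀ e ∈ C.edges, 0 ≤ 1 / 2 * C.edgeCost θ L t T z e +
      1 / 2 * C.edgeCost θ L t T w e - C.edgeCost θ L t T u e := fun e he =>
    sub_nonneg.2 (h.edgeCost_comb_le hz hw ha ha hab he)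
  -- Maximality of both pairs and concavity of `F` and `G` leave no room for a positive total gap.
  have hsum : ∑ e ∈ C.edges, (1 / 2 * C.edgeCost θ L t T z e +
      1 / 2 * C.edgeCost θ L t T w e - C.edgeCost θ L t T u e) = 0 := by
    refine le_antisymm ?_ (Finset.sum_nonneg hgap)
    rw [Finset.sum_sub_distrib, Finset.sum_add_distrib, ← Finset.mul_sum, ← Finset.mul_sum]
    linarith
  have h5 := (Finset.sum_eq_zero_iff_of_nonneg hgap).1 hsum e he
  have iz := ((mem_fluxes.1 hz).2.2 e he).2
  have iw := ((mem_fluxes.1 hw).2.2 e he).2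
  have iu := ((mem_fluxes.1 hu).2.2 e he).2
  have izw : IntegrableOn (fun s => 1 / 2 * C.cost θ L z e s + 1 / 2 * C.cost θ L w e s)
      (Icc t T) := (iz.const_mul _).add (iw.const_mul _)
  have h6 : ∫ s in Icc t T, (1 / 2 * C.cost θ L z e s + 1 / 2 * C.cost θ L w e s -
      C.cost θ L u e s) = 0 := by
    rw [integral_sub izw iu, integral_add (iz.const_mul _) (iw.const_mul _), integral_const_mul,
      integral_const_mul]
    exact h5
  have h7 := (integral_eq_zero_iff_of_nonneg_ae ((ae_restrict_iff' measurableSet_Icc).2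
    (ae_of_all _ fun s hs => sub_nonneg.2 (h.comb_cost_le hz hw ha ha hab he hs)))
    (izw.sub iu)).1 h6
  exact h7.mono fun s hs => (sub_eq_zero.1 hs).symm

/-- Where one of two maximizers has a positive density, both have the same velocity. -/
theorem flux_mul_act_eq (h : C.IsControlProblem θ L F G t T p₀)
    (hz : z ∈ C.fluxes θ L t T p₀) (hw : w ∈ C.fluxes θ L t T p₀)
    (hzm : IsMaxOn (C.fluxPayoff θ L F G t T) (C.fluxes θ L t T p₀) z)
    (hwm : IsMaxOn (C.fluxPayoff θ L F G t T) (C.fluxes θ L t T p₀) w) :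
    ∀ᵐ s ∂(volume.restrict (Icc t T)), (∀ i, 0 < z.1 s i) → ∀ i j, (i, j) ∈ C.edges →
      w.2 s i j * C.act θ (z.1 s) i j = C.act θ (w.1 s) i j * z.2 s i j := by
  have hall : ∀ᵐ s ∂(volume.restrict (Icc t T)), ∀ e : Fin n × Fin n, e ∈ C.edges →
      C.cost θ L ((1 / 2 : ℝ) • z + (1 / 2 : ℝ) • w) e s =
        1 / 2 * C.cost θ L z e s + 1 / 2 * C.cost θ L w e s := by
    refine ae_all_iff.2 fun e => ?_
    by_cases he : e ∈ C.edges
    · exact (h.cost_midpoint_eq hz hw hzm hwm he).mono fun s hs _ => hs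
    · exact ae_of_all _ fun s hs => absurd hs he
  filter_upwards [hall, ae_restrict_mem measurableSet_Icc] with s h1 hs hpos i j he
  have hzs := hz.2.1.mem_simplex s hs
  have hws := hw.2.1.mem_simplex s hs
  exact (h.isLagrangian.isCost he).mul_eq_mul_of_persp_eq (act_pos h.isActivation hpos i j)
    (act_nonneg h.isActivation hws i j) ((hw.2.2 i j he).1 s hs)
    ((C.concaveOn_act h.concaveOn i j).2 hzs hws (by norm_num) (by norm_num) (by norm_num))
    (h1 (i, j) he)

/-- Local uniqueness for the continuity equation with a given velocity field, starting from a
positive density. -/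
theorem exists_density_eq (h : C.IsControlProblem θ L F G t T p₀)
    (hz : C.SolvesContinuity t T p₀ z.1 z.2) (hw : C.SolvesContinuity t T p₀ w.1 w.2)
    {x y : ℝ} (htx : t ≤ x) (hxy : x < y) (hyT : y ≤ T) (hpos : ∀ i, 0 < z.1 x i)
    (hx : z.1 x = w.1 x)
    (hv : ∀ᵐ s ∂(volume.restrict (Icc t T)), s ∈ Ico x y → ∀ i j, (i, j) ∈ C.edges →
      w.2 s i j * C.act θ (z.1 s) i j = C.act θ (w.1 s) i j * z.2 s i j) :
    ∃ u ∈ Ioc x y, z.1 u = w.1 u := by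
  choose κ hκ0 U hU hκ using fun e : Fin n × Fin n =>
    C.exists_act_sub_le h.isActivation hpos e.1 e.2
  have hUall : ⋂ e, U e ∈ 𝓝 (z.1 x) := iInter_mem.2 hU
  have hxT : x < T := hxy.trans_le hyT
  have hxm : x ∈ Icc t T := ⟨htx, hxT.le⟩
  -- `g` is an integrable Lipschitz rate, in the density, for the flow with the velocity of `z`; the
  -- interval is shortened until its integral is below `1 / 2`, making the estimate a contraction.
  let g : ℝ → ℝ := fun s => ∑ i, ∑ j ∈ C.nbhd i, √(C.weight i j) * (κ (i, j) * |z.2 s i j|)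
  have hg : IntegrableOn g (Icc t T) := integrable_finsetSum _ fun i _ =>
    integrable_finsetSum _ fun j hj =>
      (((hz.integrable i j (mem_nbhd.1 hj)).abs).const_mul _).const_mul _
  have hg0 : ∀ s, 0 ≤ g s := fun s => Finset.sum_nonneg fun i _ => Finset.sum_nonneg fun j _ =>
    mul_nonneg (Real.sqrt_nonneg _) (mul_nonneg (hκ0 _) (abs_nonneg _))
  have hsub : Icc x T ⊆ Icc t T := Icc_subset_Icc_left htx
  have hcont : ∀ p : ℝ → Fin n → ℝ, ContinuousOn p (Icc t T) →
      Tendsto p (𝓝[≥] x) (𝓝 (p x)) := fun p hp => by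
    rw [← nhdsWithin_Icc_eq_nhdsGE hxT]
    exact (hp.mono hsub) x (left_mem_Icc.2 hxT.le)
  have hprim : Tendsto (fun s => ∫ r in x..s, g r) (𝓝[≥] x) (𝓝 0) := by
    have hc := intervalIntegral.continuousOn_primitive_interval (a := x) (b := T)
      (by rw [uIcc_of_le hxT.le]; exact hg.mono_set hsub)
    rw [uIcc_of_le hxT.le] at hc
    have := hc x (left_mem_Icc.2 hxT.le)
    rw [ContinuousWithinAt, nhdsWithin_Icc_eq_nhdsGE hxT, intervalIntegral.integral_same] at this
    exact this
  have hev : ∀ᶠ s in 𝓝[≥] x, s < y ∧ z.1 s ∈ ⋂ e, U e ∧ w.1 s ∈ ⋂ e, U e ∧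
      ∫ r in x..s, g r < 1 / 2 := by
    refine ((eventually_lt_nhds hxy).filter_mono nhdsWithin_le_nhds).and
      (((hcont _ hz.continuousOn).eventually_mem hUall).and
      (((hcont _ hw.continuousOn).eventually_mem (hx ▸ hUall)).and
      (hprim.eventually_lt_const (by norm_num))))
  obtain ⟨u, hxu, hu⟩ := mem_nhdsGE_iff_exists_Icc_subset.1 hev
  have hxu : x < u := hxu
  have huy : u < y := (hu (right_mem_Icc.2 hxu.le)).1
  have hsubu : Icc x u ⊆ Icc t T := (Icc_subset_Icc_right (huy.le.trans hyT)).trans hsub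
  obtain ⟨s₀, hs₀, hmax⟩ := isCompact_Icc.exists_isMaxOn (nonempty_Icc.2 hxu.le)
    ((hw.continuousOn.sub hz.continuousOn).norm.mono hsubu)
  set D := ‖w.1 s₀ - z.1 s₀‖
  have hD : ∀ s ∈ Icc x u, ‖w.1 s - z.1 s‖ ≤ D := fun s hs => hmax hs
  have hD0 : 0 ≤ D := norm_nonneg _
  have hflux : ∀ᵐ s ∂(volume.restrict (Icc t T)), s ∈ Icc x u → ∀ i,
      |C.divergence (w.2 s) i - C.divergence (z.2 s) i| ≤ g s * D := by
    filter_upwards [hv] with s hs hsu i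
    have hs' := hs ⟨hsu.1, hsu.2.trans_lt huy⟩
    have hle : ∀ j ∈ C.nbhd i, |w.2 s i j - z.2 s i j| ≤ κ (i, j) * |z.2 s i j| * D := by
      intro j hj
      obtain ⟨ha, hb⟩ := hκ (i, j) (z.1 s) (mem_iInter.1 (hu hsu).2.1 _) (w.1 s)
        (mem_iInter.1 (hu hsu).2.2.1 _)
      have e1 := hs' i j (mem_nbhd.1 hj)
      simp only at ha hb
      -- Multiplying by the positive activation of `z` lets the equality of velocities be used
      -- without division.
      refine le_of_mul_le_mul_right ?_ ha
      calc |w.2 s i j - z.2 s i j| * C.act θ (z.1 s) i j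
          = |(C.act θ (w.1 s) i j - C.act θ (z.1 s) i j) * z.2 s i j| := by
            rw [← abs_of_pos ha, ← abs_mul, abs_of_pos ha, sub_mul, e1]
            congr 1
            ring
        _ ≤ (κ (i, j) * ‖w.1 s - z.1 s‖ * C.act θ (z.1 s) i j) * |z.2 s i j| := by
            rw [abs_mul]
            exact mul_le_mul_of_nonneg_right hb (abs_nonneg _)
        _ ≤ (κ (i, j) * D * C.act θ (z.1 s) i j) * |z.2 s i j| := by
            have := hκ0 (i, j)
            have := hD s hsu
            gcongr
        _ = κ (i, j) * |z.2 s i j| * D * C.act θ (z.1 s) i j := by ring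
    rw [divergence_sub]
    refine (Finset.abs_sum_le_sum_abs _ _).trans ?_
    calc ∑ j ∈ C.nbhd i, |√(C.weight i j) * (w.2 s i j - z.2 s i j)|
        ≤ ∑ j ∈ C.nbhd i, √(C.weight i j) * (κ (i, j) * |z.2 s i j|) * D := by
          refine Finset.sum_le_sum fun j hj => ?_
          rw [abs_mul, abs_of_nonneg (Real.sqrt_nonneg _), mul_assoc]
          exact mul_le_mul_of_nonneg_left (hle j hj) (Real.sqrt_nonneg _)
      _ = (∑ j ∈ C.nbhd i, √(C.weight i j) * (κ (i, j) * |z.2 s i j|)) * D := by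
          rw [Finset.sum_mul]
      _ ≤ g s * D := by
          refine mul_le_mul_of_nonneg_right ?_ hD0
          exact Finset.single_le_sum
            (f := fun i => ∑ j ∈ C.nbhd i, √(C.weight i j) * (κ (i, j) * |z.2 s i j|))
            (fun i _ => Finset.sum_nonneg fun j _ =>
              mul_nonneg (Real.sqrt_nonneg _) (mul_nonneg (hκ0 _) (abs_nonneg _)))
            (Finset.mem_univ i)
  -- `D` is the largest distance on the interval, attained at `s₀`; integrating the flux estimate up
  -- to `s₀` bounds it by half of itself.
  have hbound : D ≤ 1 / 2 * D := by
    refine (pi_norm_le_iff_of_nonneg (by positivity)).2 fun i => ?_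
    have hs₀m := hsubu hs₀
    have e1 := hw.sub_eq hxm hs₀m i
    have e2 := hz.sub_eq hxm hs₀m i
    have e3 : w.1 s₀ i - z.1 s₀ i =
        -∫ r in x..s₀, (C.divergence (w.2 r) i - C.divergence (z.2 r) i) := by
      rw [intervalIntegral.integral_sub (hw.intervalIntegrable hxm hs₀m i)
        (hz.intervalIntegrable hxm hs₀m i)]
      have := congrFun hx i
      linarith
    have e4 : ‖∫ r in x..s₀, (C.divergence (w.2 r) i - C.divergence (z.2 r) i)‖ ≤
        ∫ r in x..s₀, g r * D := by
      refine intervalIntegral.norm_integral_le_of_norm_le hs₀.1 ?_ ?_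
      · filter_upwards [(ae_restrict_iff' measurableSet_Icc).1 hflux] with r hr hrm
        have hru : r ∈ Icc x u := ⟨hrm.1.le, hrm.2.trans hs₀.2⟩
        exact hr (hsubu hru) hru i
      · refine (intervalIntegrable_iff_integrableOn_Icc_of_le hs₀.1).2 ?_
        exact (hg.mono_set ((Icc_subset_Icc_right hs₀.2).trans hsubu)).mul_const D
    rw [intervalIntegral.integral_mul_const] at e4
    rw [Pi.sub_apply, e3, norm_neg]
    exact e4.trans (mul_le_mul_of_nonneg_right (hu hs₀).2.2.2.le hD0)
  refine ⟨u, ⟨hxu, huy.le⟩, ?_⟩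
  have h1 := hD u (right_mem_Icc.2 hxu.le)
  have h2 : ‖w.1 u - z.1 u‖ = 0 := le_antisymm (by linarith) (norm_nonneg _)
  exact (sub_eq_zero.1 (norm_eq_zero.1 h2)).symm

/-- Continuous induction: the densities agree on a closed set of times that contains `t` and, by
local uniqueness, extends to the right of each of its points before `τ`. Equal densities and
velocities then give equal fluxes. -/
theorem eq_of_isMaxOn (h : C.IsControlProblem θ L F G t T p₀)
    (hz : z ∈ C.fluxes θ L t T p₀) (hw : w ∈ C.fluxes θ L t T p₀)
    (hzm : IsMaxOn (C.fluxPayoff θ L F G t T) (C.fluxes θ L t T p₀) z)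
    (hwm : IsMaxOn (C.fluxPayoff θ L F G t T) (C.fluxes θ L t T p₀) w)
    {τ : ℝ} (hτ : τ ∈ Icc t T) (hpos : ∀ s ∈ Ico t τ, ∀ i, 0 < z.1 s i) :
    (∀ s ∈ Icc t τ, z.1 s = w.1 s) ∧
      ∀ᵐ s ∂(volume.restrict (Icc t τ)), ∀ i j, (i, j) ∈ C.edges → z.2 s i j = w.2 s i j := by
  have hv := h.flux_mul_act_eq hz hw hzm hwm
  have hsub : Icc t τ ⊆ Icc t T := Icc_subset_Icc_right hτ.2
  have hp : Icc t τ ⊆ {s | z.1 s = w.1 s} := by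
    refine IsClosed.Icc_subset_of_forall_exists_gt ?_ ?_ ?_
    · have := ((hz.2.1.continuousOn.sub hw.2.1.continuousOn).mono
        hsub).preimage_isClosed_of_isClosed isClosed_Icc (isClosed_singleton (x := 0))
      convert this using 1
      ext s
      simp [sub_eq_zero, and_comm]
    · exact (hz.2.1.apply_left h.le).trans (hw.2.1.apply_left h.le).symm
    · rintro x ⟨hx, hxm⟩ y hy
      have hy' : x < min y τ := lt_min hy hxm.2
      obtain ⟨u, hu, hue⟩ := h.exists_density_eq hz.2.1 hw.2.1 hxm.1 hy'
        ((min_le_right _ _).trans hτ.2) (hpos x hxm) hx (hv.mono fun s hs hsm =>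
          hs (hpos s ⟨hxm.1.trans hsm.1, hsm.2.trans_le (min_le_right _ _)⟩))
      exact ⟨u, hue, hu.1, hu.2.trans (min_le_left _ _)⟩
  refine ⟨fun s hs => hp hs, ?_⟩
  -- The time `τ` is discarded as a null set, since the density may vanish there.
  filter_upwards [ae_restrict_of_ae_restrict_of_subset hsub hv,
    ae_restrict_mem measurableSet_Icc, Measure.ae_ne _ τ] with s h1 hs hne i j he
  have hps := hpos s ⟨hs.1, lt_of_le_of_ne hs.2 hne⟩
  have h2 := h1 hps i j he
  rw [← show z.1 s = w.1 s from hp hs, mul_comm] at h2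
  exact (mul_left_cancel₀ (act_pos h.isActivation hps i j).ne' h2).symm

end IsControlProblem

end ReversibleChain

end

theorem mainTheorem1 {n : ℕ} (C : ReversibleChain n)
    (θ : ℝ → ℝ → ℝ) (hθ : IsActivation θ)
    (hθc : ConcaveOn ℝ (Ici (0 : ℝ) ×ˢ Ici (0 : ℝ)) (fun z : ℝ × ℝ => θ z.1 z.2))
    (L : Fin n → Fin n → ℝ → ℝ) (hL : IsLagrangian C L)
    (F G : (Fin n → ℝ) → ℝ)
    (hF : ContDiffOn ℝ 1 F (stdSimplex ℝ (Fin n))) (hFc : ConcaveOn ℝ (stdSimplex ℝ (Fin n)) F)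
    (hG : ContDiffOn ℝ 1 G (stdSimplex ℝ (Fin n))) (hGc : ConcaveOn ℝ (stdSimplex ℝ (Fin n)) G)
    (t T : ℝ) (htT : t ≤ T) (p₀ : Fin n → ℝ) (hp₀ : p₀ ∈ stdSimplex ℝ (Fin n)) :
    -- the change of variables turns the control problem into the density-flux problem
    (∀ p v, (p, v) ∈ C.controls θ L t T p₀ →
      (p, C.flux θ p v) ∈ C.fluxes θ L t T p₀ ∧
        C.fluxPayoff θ L F G t T (p, C.flux θ p v) = C.controlPayoff θ L F G t T (p, v)) ∧
    (∀ p m, (p, m) ∈ C.fluxes θ L t T p₀ →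
      ∃ v, (p, v) ∈ C.controls θ L t T p₀ ∧
        ∀ s ∈ Icc t T, ∀ i j, (i, j) ∈ C.edges → m s i j = C.flux θ p v s i j) ∧
    -- which is a convex optimization problem
    ConcaveOn ℝ (C.fluxes θ L t T p₀) (C.fluxPayoff θ L F G t T) ∧
    -- the two problems have the same finite value, and the second one has a solution
    IsLUB (C.controlPayoff θ L F G t T '' C.controls θ L t T p₀) (C.value θ L F G t T p₀) ∧
    IsGreatest (C.fluxPayoff θ L F G t T '' C.fluxes θ L t T p₀) (C.value θ L F G t T p₀) ∧
    -- the value is the same for continuously differentiable pairs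
    IsLUB (C.fluxPayoff θ L F G t T '' {z ∈ C.fluxes θ L t T p₀ | IsC1Pair t T z})
      (C.value θ L F G t T p₀) ∧
    ((∀ i, 0 < p₀ i) →
      IsLUB (C.controlPayoff θ L F G t T '' {z ∈ C.controls θ L t T p₀ | IsC1Pair t T z})
        (C.value θ L F G t T p₀)) ∧
    -- the solution is unique as long as the density is positive
    (∀ z ∈ C.fluxes θ L t T p₀, ∀ w ∈ C.fluxes θ L t T p₀,
      IsMaxOn (C.fluxPayoff θ L F G t T) (C.fluxes θ L t T p₀) z →
      IsMaxOn (C.fluxPayoff θ L F G t T) (C.fluxes θ L t T p₀) w →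
      ∀ τ ∈ Icc t T, (∀ s ∈ Ico t τ, ∀ i, 0 < z.1 s i) →
        (∀ s ∈ Icc t τ, z.1 s = w.1 s) ∧
        ∀ᵐ s ∂(volume.restrict (Icc t τ)), ∀ i j, (i, j) ∈ C.edges →
          z.2 s i j = w.2 s i j) := by
  have h : C.IsControlProblem θ L F G t T p₀ :=
    ⟨hθ, hθc, hL, hF.continuousOn, hFc, hG.continuousOn, hGc, htT, hp₀⟩
  refine ⟨fun p v hv => h.flux_mem_fluxes hv,
    fun p m hm => ⟨_, (h.exists_control hm).1, (h.exists_control hm).2.1⟩,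
    h.concaveOn_fluxPayoff, ?_, h.isGreatest_fluxPayoff, h.isLUB_fluxPayoff_isC1Pair,
    h.isLUB_controlPayoff_isC1Pair, fun z hz w hw hzm hwm τ hτ hpos =>
      h.eq_of_isMaxOn hz hw hzm hwm hτ hpos⟩
  rw [h.image_controlPayoff]
  exact h.isLUB_fluxPayoff
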